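/- Let $a,b,c,q,\alpha,c_0\in\mathbb C$ with $a\ne b$, $a\ne c$, and let $\lambda\in\{0,\tfrac12\}$. Write $z=x-a$, $D=(a-b)(a-c)$, $s=2a-b-c$, $\eta=-z^2/D$, $\mu=-z/D$, and let $z^\lambda=e^{\lambda L(z)}$, where $L$ is any continuous branch of the logarithm on an open set $U\subset\mathbb C\setminus\{0\}$. Consider Lamé's equation $$y''+\tfrac12\Big(\tfrac1{x-a}+\tfrac1{x-b}+\tfrac1{x-c}\Big)y'+\frac{-\alpha(\alpha+1)x+q}{4(x-a)(x-b)(x-c)}\,y=0 ,$$ whose Frobenius series $\sum_{N\ge0}c_Nz^{N+\lambda}$ satisfies $c_1=A_0c_0$ and $c_{N+1}=A_Nc_N+B_Nc_{N-1}$ for $N\ge1$, with $$A_N=\frac{\frac14(\alpha(\alpha+1)a-q)-s(N+\lambda)^2}{D(N+1+\lambda)(N+\frac12+\lambda)},\qquad B_N=\frac{[\alpha-(1-2(N+\lambda))][\alpha-2(N-1+\lambda)]}{4D(N+1+\lambda)(N+\frac12+\lambda)} .$$ Let $y_n(z)=\sum_N c_N^{(n)}z^{N+\lambda}$, where $c_N^{(n)}$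 is the part of $c_N$ made up of the products containing exactly $n$ factors $A_j$. For $|w|<1$ put $$G_0(w)=\sum_{i\ge0}\frac{(-\frac\alpha4+\frac\lambda2)_i(\frac\alpha4+\frac14+\frac\lambda2)_i}{(1+\frac\lambda2)_i(\frac34+\frac\lambda2)_i}\,w^i ,$$ and for $l\ge1$ define recursively $$\begin{aligned}G_l(w)=&\int_0^1\!dt\,t^{\frac12(l-\frac52+\lambda)}\int_0^1\!du\,u^{\frac12(l-2+\lambda)}\,\frac1{2\pi i}\oint\frac{dv}{v}\Big(\frac{v-1}v\Big)^{\frac12(\frac\alpha2-l-\lambda)}\big(1-wv(1-t)(1-u)\big)^{-\frac12(\frac\alpha2+\frac12+l+\lambda)}\\&\times\Big[\Big(s\,W^{-\frac12(l-1+\lambda)}(W\partial_W)^2W^{\frac12(l-1+\lambda)}-\tfrac a{16}\alpha(\alpha+1)+\tfrac q{16}\Big)G_{l-1}\Big](W),\qquad W=\frac1{v-1}\,\frac{w\,v\,t\,u}{1-wv(1-t)(1-u)} .\end{aligned}$$ Here $W^{-\beta}(W\partial_W)^2W^{\beta}$ denotes the operator $(W\partial_W+\beta)^2$, the non-integer powers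 of complex numbers are principal, and for each $l,w$ and $t,u\in(0,1)$ the contour is any positively oriented circle $|v|=r$ with $r>1$, $|w|(1-t)(1-u)r<1$ and $|W|<1$ on it; the choice may depend on $l,w,t,u$. Then such circles exist for all $|w|<1$ and $t,u\in(0,1)$, and for every choice of them: (i) For $|w|<1$ the series $G_0(w)$ converges and equals ${}_2F_1(-\frac\alpha4+\frac\lambda2,\frac\alpha4+\frac14+\frac\lambda2;\frac34+\lambda;w)$. For each $n\ge0$, $G_n$ is holomorphic in $|w|<1$. For each $l\ge1$ and $|w|<1$, the integrand of the contour integral defining $G_l(w)$ is integrable along the chosen circle for all $t,u\in(0,1)$, and the remaining integrand is integrable in $(t,u)$ over $(0,1)^2$. (ii) If $z\in U$ and $|z|^2<|D|$, then for every $n\ge0$ the series $y_n(z)$ converges and $y_n(z)=c_0z^\lambda\,G_n(\eta)\,\mu^n$, an $n$-fold nested integral. (iii) If $z\in U$, $|z|^2<|D|$ and $|sz|<|D+z^2|$, then $$y(z)=\sum_{n\ge0}y_n(z)=c_0z^\lambda\Big\{G_0(\eta)+\sum_{n\ge1}G_n(\eta)\,\mu^n\Big\}$$ converges absolutely, and $y$,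 as a function of $x=a+z$, is analytic and satisfies Lamé's equation there. If moreover $|z|<\min(|a-b|,|a-c|)$, then $\sum_Nc_Nz^{N+\lambda}$ converges and equals $y(z)$. -/

import Mathlib

noncomputable section

/-! ## The Lamé equation in algebraic form and its Frobenius recurrence about `x = a` -/

/-- `Y` is analytic at `x` and satisfies the algebraic Lamé equation there. -/
def IsLameSolutionAt (a b c q α : ℂ) (Y : ℂ → ℂ) (x : ℂ) : Prop :=
  AnalyticAt ℂ Y x ∧
    deriv (deriv Y) x + 1 / 2 * (1 / (x - a) + 1 / (x - b) + 1 / (x - c)) * deriv Y x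
      + (-α * (α + 1) * x + q) / (4 * (x - a) * (x - b) * (x - c)) * Y x = 0

/-- The coefficient `A_n` of the three-term recurrence `c_{n+1} = A_n c_n + B_n c_{n-1}`. -/
def lameA (a b c q α lam : ℂ) (n : ℕ) : ℂ :=
  (1 / 4 * (α * (α + 1) * a - q) - (2 * a - b - c) * (n + lam) ^ 2) /
    ((a - b) * (a - c) * (n + 1 + lam) * (n + 1 / 2 + lam))

/-- The coefficient `B_n` of the three-term recurrence. -/
def lameB (a b c α lam : ℂ) (n : ℕ) : ℂ :=
  ((α - (1 - 2 * (n + lam))) * (α - 2 * (n - 1 + lam))) /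
    (2 ^ 2 * (a - b) * (a - c) * (n + 1 + lam) * (n + 1 / 2 + lam))

/-- The Frobenius coefficients `c_n` with given `c_0`. -/
def frobCoeff (a b c q α lam c₀ : ℂ) : ℕ → ℂ
  | 0 => c₀
  | 1 => lameA a b c q α lam 0 * c₀
  | n + 2 => lameA a b c q α lam (n + 1) * frobCoeff a b c q α lam c₀ (n + 1)
      + lameB a b c α lam (n + 1) * frobCoeff a b c q α lam c₀ n

/-- `subCoeff … n m` is the part of `c_n` consisting of the products of `A`'s and `B`'s
that contain exactly `m` factors `A`. -/
def subCoeff (a b c q α lam c₀ : ℂ) : ℕ → ℕ → ℂ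
  | 0, 0 => c₀
  | 0, _ + 1 => 0
  | 1, 0 => 0
  | 1, m + 1 => lameA a b c q α lam 0 * subCoeff a b c q α lam c₀ 0 m
  | n + 2, 0 => lameB a b c α lam (n + 1) * subCoeff a b c q α lam c₀ n 0
  | n + 2, m + 1 => lameA a b c q α lam (n + 1) * subCoeff a b c q α lam c₀ (n + 1) m
      + lameB a b c α lam (n + 1) * subCoeff a b c q α lam c₀ n (m + 1)

/-- `η = -z² / ((a-b)(a-c))`. -/
def lameEta (a b c z : ℂ) : ℂ := -z ^ 2 / ((a - b) * (a - c))

/-- `μ = -z / ((a-b)(a-c))`. -/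
def lameMu (a b c z : ℂ) : ℂ := -z / ((a - b) * (a - c))

/-! ## The integral operators -/

/-- The series `∑ (-α/4+λ/2)_i (α/4+1/4+λ/2)_i / ((1+λ/2)_i (3/4+λ/2)_i) w^i`. -/
def lameSeries (α lam w : ℂ) : ℂ :=
  ∑' i : ℕ, (ascPochhammer ℂ i).eval (-α / 4 + lam / 2)
      * (ascPochhammer ℂ i).eval (α / 4 + 1 / 4 + lam / 2)
    / ((ascPochhammer ℂ i).eval (1 + lam / 2) * (ascPochhammer ℂ i).eval (3 / 4 + lam / 2)) * w ^ i

/-- The operator `w^{-β} (w ∂_w) w^{β}`, i.e. `w ∂_w + β`, whatever the branch of `w^β`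
(see `eulerConj_eq` and `eulerConj_sq_eq`). -/
def eulerConj (β : ℂ) (f : ℂ → ℂ) : ℂ → ℂ := fun w => w * deriv f w + β * f w

theorem eulerConj_eq (β : ℂ) {f : ℂ → ℂ} {w : ℂ} (hw : w ∈ Complex.slitPlane)
    (hf : DifferentiableAt ℂ f w) :
    eulerConj β f w = w ^ (-β) * (w * deriv (fun x => x ^ β * f x) w) := by
  have hw0 : w ≠ 0 := Complex.slitPlane_ne_zero hw
  have h1 : HasDerivAt (fun x : ℂ => x ^ β) (β * w ^ (β - 1)) w := by
    simpa using (hasDerivAt_id w).cpow_const (c := β) hw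
  have h2 := (h1.mul hf.hasDerivAt).deriv
  have h2' : deriv (fun x => x ^ β * f x) w = β * w ^ (β - 1) * f w + w ^ β * deriv f w := h2
  have h3 : w ^ β ≠ 0 := by simp [Complex.cpow_eq_zero_iff, hw0]
  rw [h2', Complex.cpow_neg, Complex.cpow_sub _ _ hw0, Complex.cpow_one, eulerConj]
  field_simp
  ring

/-- `(w ∂_w + β)² f = w^{-β} (w ∂_w)² (w^β f)`. -/
theorem eulerConj_sq_eq (β : ℂ) {f : ℂ → ℂ} {w : ℂ} (hw : w ∈ Complex.slitPlane)
    (hf : AnalyticAt ℂ f w) :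
    eulerConj β (eulerConj β f) w =
      w ^ (-β) * (w * deriv (fun x => x * deriv (fun y => y ^ β * f y) x) w) := by
  have hg : DifferentiableAt ℂ (eulerConj β f) w :=
    (differentiableAt_id.mul hf.deriv.differentiableAt).add (hf.differentiableAt.const_mul β)
  rw [eulerConj_eq β hw hg]
  congr 2
  apply Filter.EventuallyEq.deriv_eq
  filter_upwards [Complex.isOpen_slitPlane.mem_nhds hw, hf.eventually_analyticAt] with x hx hfx
  have hx0 : x ≠ 0 := Complex.slitPlane_ne_zero hx
  have h3 : x ^ β ≠ 0 := by simp [Complex.cpow_eq_zero_iff, hx0]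
  rw [eulerConj_eq β hx hfx.differentiableAt, Complex.cpow_neg, ← mul_assoc, mul_inv_cancel₀ h3,
    one_mul]

/-- `(2a-b-c) w^{-β}(w∂_w)² w^{β} - (a/2⁴) α(α+1) + q/2⁴`, applied to `f`. -/
def lameDiffOp (a b c q α β : ℂ) (f : ℂ → ℂ) : ℂ → ℂ := fun w =>
  (2 * a - b - c) * eulerConj β (eulerConj β f) w
    + (-(a / 2 ^ 4) * α * (α + 1) + q / 2 ^ 4) * f w

/-- The substitution `w_{l,n}` in terms of `w = w_{l+1,n}` and `t = t_l`, `u = u_l`, `v = v_l`. -/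
def lameW (w : ℂ) (t u : ℝ) (v : ℂ) : ℂ :=
  1 / (v - 1) * (w * v * t * u / (1 - w * v * (1 - t) * (1 - u)))

/-- The integrand of the contour integral at level `l`, with principal powers. -/
def contourIntegrand (a b c q α lam : ℂ) (l : ℕ) (f : ℂ → ℂ) (w : ℂ) (t u : ℝ) (v : ℂ) : ℂ :=
  1 / v * ((v - 1) / v) ^ (1 / 2 * (α / 2 - l - lam))
    * (1 - w * v * (1 - t) * (1 - u)) ^ (-(1 / 2 * (α / 2 + 1 / 2 + l + lam)))
    * lameDiffOp a b c q α (1 / 2 * (l - 1 + lam)) f (lameW w t u v)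

/-- The normalised contour integral over the circle `|v| = r`. -/
def contourTerm (a b c q α lam : ℂ) (l : ℕ) (f : ℂ → ℂ) (w : ℂ) (t u r : ℝ) : ℂ :=
  1 / (2 * Real.pi * Complex.I) *
    ∮ v in C(0, r), contourIntegrand a b c q α lam l f w t u v

/-- The circle `|v| = r` encloses the branch points `0` and `1`, does not enclose the branch
point `1 / (w(1-t)(1-u))`, and the new variable stays in the unit disc along it. -/
def AdmissibleRadius (w : ℂ) (t u r : ℝ) : Prop :=
  1 < r ∧ ‖w‖ * ((1 - t) * (1 - u)) * r < 1 ∧ ∀ v : ℂ, ‖v‖ = r → ‖lameW w t u v‖ < 1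

/-- A choice of an admissible circle at every level `l`, for all `|w| < 1` and `0 < t, u < 1`. -/
def AdmissibleContours (ρ : ℕ → ℂ → ℝ → ℝ → ℝ) : Prop :=
  ∀ (l : ℕ) (w : ℂ), ‖w‖ < 1 → ∀ t ∈ Set.Ioo (0 : ℝ) 1, ∀ u ∈ Set.Ioo (0 : ℝ) 1,
    AdmissibleRadius w t u (ρ l w t u)

/-- The `l`-th integral operator: Beta-type integrals over `t`, `u`, a contour integral over `v`,
and the differential operator acting on `f` in the new variable. -/
def lameStep (a b c q α lam : ℂ) (ρ : ℕ → ℂ → ℝ → ℝ → ℝ) (l : ℕ) (f : ℂ → ℂ) (w : ℂ) : ℂ :=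
  ∫ t in (0 : ℝ)..1, (t : ℂ) ^ (1 / 2 * (l - 5 / 2 + lam)) *
    ∫ u in (0 : ℝ)..1, (u : ℂ) ^ (1 / 2 * (l - 2 + lam)) *
      contourTerm a b c q α lam l f w t u (ρ l w t u)

/-- The `n`-fold nested integral as a function of `w = w_{n+1,n}`: the operators at levels
`n, n-1, …, 1`, the outermost one being level `n`, applied to the hypergeometric series. -/
def lameNested (a b c q α lam : ℂ) (ρ : ℕ → ℂ → ℝ → ℝ → ℝ) : ℕ → ℂ → ℂ
  | 0 => lameSeries α lam
  | n + 1 => lameStep a b c q α lam ρ (n + 1) (lameNested a b c q α lam ρ n)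

end

/-! Everything is reduced to power series coefficients. Applied to `∑ h j * W ^ j`, the integral
operator can be computed exactly: each power of `W` shifts the two kernel parameters by one, the
binomial series in `1/v` and in `v` leave only diagonal terms under the contour integral
(`hasSum_circleIntegral_kernel`), and the `t` and `u` integrals are beta integrals. The resulting
coefficients `stepCoeff` obey a two-term recurrence with source `h` (`stepCoeff_succ`). Grouping the
products in the Frobenius recurrence by their number of factors `A` gives the same recurrence, with
the preceding group as source. Hence `subCoeff_eq_nestedCoeff`, and the representation of each part
as a nested integral. The radius of the circle disappears from the result, so its choice is
immaterial.

For the sum over `n`, let `θ = z d/dz + λ`. Lamé's operator splits into a part even in `z`, with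
leading coefficient `D + z²`, and the odd part `z (s θ² + k)`; the even part of level `n + 1` is
driven by the odd part of level `n`. With weights `ε ^ n`, `ε > 1`, this coupling is dominated as
long as `ε |s z|` stays below `|D + z²|`. Gronwall's inequality along the ray from near `0` to `z`
then bounds the weighted levels uniformly in `n` (`weighted_ray_bound`), and the levels decay
geometrically. The region is star-shaped (`mul_norm_add_sq_le`), so the ray stays inside it. Local
uniformity of the bound permits termwise differentiation, and the level equations add up to Lamé's
equation (`frobSum_facts`).

The Frobenius series converges up to the nearer singularity by a perturbed-recurrence estimate
(`psConv_of_three_term`). It equals the regrouped sum near `0` by absolute convergence, and further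
out by the identity theorem. -/

section

open Filter Topology MeasureTheory

/-! ### Power series in a disc and the Euler operator -/

/-- The power series with coefficients `c` converges absolutely in the disc of radius `R`. -/
def PSConv (c : ℕ → ℂ) (R : ℝ) : Prop :=
  ∀ r : ℝ, 0 ≤ r → r < R → Summable fun N => ‖c N‖ * r ^ N

/-- The sum of the power series with coefficients `c`. -/
noncomputable def psum (c : ℕ → ℂ) (z : ℂ) : ℂ := ∑' N, c N * z ^ N

theorem hasSum_congr {ι : Type*} {f g : ι → ℂ} {x : ℂ} (h : ∀ i, f i = g i) :
    HasSum f x ↔ HasSum g x := by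
  rw [funext h]

theorem PSConv.summable_norm {c : ℕ → ℂ} {R : ℝ} (hc : PSConv c R) {z : ℂ} (hz : ‖z‖ < R) :
    Summable fun N => ‖c N * z ^ N‖ := by
  simpa using hc ‖z‖ (norm_nonneg _) hz

theorem PSConv.hasSum {c : ℕ → ℂ} {R : ℝ} (hc : PSConv c R) {z : ℂ} (hz : ‖z‖ < R) :
    HasSum (fun N => c N * z ^ N) (psum c z) :=
  (hc.summable_norm hz).of_norm.hasSum

theorem exists_forall_add_mul_pow_le (β : ℂ) {ρ : ℝ} (h0 : 0 ≤ ρ) (h1 : ρ < 1) :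
    ∃ C : ℝ, ∀ N : ℕ, ‖(N : ℂ) + β‖ * ρ ^ N ≤ C := by
  have h2 : Tendsto (fun N : ℕ => (N : ℝ) ^ 1 * ρ ^ N) atTop (𝓝 0) :=
    tendsto_pow_const_mul_const_pow_of_abs_lt_one 1 (by rwa [abs_of_nonneg h0])
  obtain ⟨C, hC⟩ := h2.bddAbove_range
  refine ⟨C + ‖β‖, fun N => ?_⟩
  have h3 : (N : ℝ) ^ 1 * ρ ^ N ≤ C := hC ⟨N, rfl⟩
  calc ‖(N : ℂ) + β‖ * ρ ^ N ≤ (N + ‖β‖) * ρ ^ N := by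
        gcongr
        exact (norm_add_le _ _).trans (by simp)
    _ = (N : ℝ) ^ 1 * ρ ^ N + ‖β‖ * ρ ^ N := by ring
    _ ≤ C + ‖β‖ * 1 := by
        gcongr
        exact pow_le_one₀ h0 h1.le
    _ = C + ‖β‖ := by ring

/-- The gap between `r` and a slightly larger radius `r'` absorbs the linear factor, so the Euler
operator costs no radius of convergence. -/
theorem PSConv.add_mul {c : ℕ → ℂ} {R : ℝ} (hc : PSConv c R) (β : ℂ) :
    PSConv (fun N => ((N : ℂ) + β) * c N) R := by
  intro r h0 hr
  obtain ⟨r', h1, h2⟩ := exists_between hr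
  have hr' : 0 < r' := h0.trans_lt h1
  obtain ⟨C, hC⟩ := exists_forall_add_mul_pow_le β (div_nonneg h0 hr'.le) ((div_lt_one hr').2 h1)
  refine Summable.of_nonneg_of_le (fun N => by positivity) (fun N => ?_)
    ((hc r' hr'.le h2).mul_left C)
  calc ‖((N : ℂ) + β) * c N‖ * r ^ N
      = (‖(N : ℂ) + β‖ * (r / r') ^ N) * (‖c N‖ * r' ^ N) := by
        rw [norm_mul, div_pow]
        field_simp
    _ ≤ C * (‖c N‖ * r' ^ N) := by
        gcongr
        exact hC N

theorem PSConv.const_mul {c : ℕ → ℂ} {R : ℝ} (hc : PSConv c R) (k : ℂ) :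
    PSConv (fun N => k * c N) R := fun r h0 hr => by
  simpa [mul_assoc] using (hc r h0 hr).mul_left ‖k‖

theorem PSConv.add {c d : ℕ → ℂ} {R : ℝ} (hc : PSConv c R) (hd : PSConv d R) :
    PSConv (fun N => c N + d N) R := fun r h0 hr => by
  refine Summable.of_nonneg_of_le (fun N => by positivity) (fun N => ?_)
    ((hc r h0 hr).add (hd r h0 hr))
  rw [← _root_.add_mul]
  gcongr
  exact norm_add_le _ _

theorem PSConv.differentiableOn_and_hasSum_deriv {c : ℕ → ℂ} {R : ℝ} (hc : PSConv c R) :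
    DifferentiableOn ℂ (psum c) (Metric.ball 0 R) ∧ ∀ z ∈ Metric.ball (0 : ℂ) R,
      HasSum (fun N : ℕ => c N * (N * z ^ (N - 1))) (deriv (psum c) z) := by
  have key : ∀ z ∈ Metric.ball (0 : ℂ) R, DifferentiableAt ℂ (psum c) z ∧
      HasSum (fun N : ℕ => c N * (N * z ^ (N - 1))) (deriv (psum c) z) := by
    intro z hz
    rw [mem_ball_zero_iff] at hz
    obtain ⟨r, h1, h2⟩ := exists_between hz
    have hr := (norm_nonneg z).trans h1.le
    have hU : IsOpen (Metric.ball (0 : ℂ) r) := Metric.isOpen_ball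
    have hzU : z ∈ Metric.ball (0 : ℂ) r := by simpa using h1
    have hd : ∀ N : ℕ, DifferentiableOn ℂ (fun z : ℂ => c N * z ^ N) (Metric.ball 0 r) :=
      fun N => by fun_prop
    have hb : ∀ (N : ℕ) (w : ℂ), w ∈ Metric.ball (0 : ℂ) r → ‖c N * w ^ N‖ ≤ ‖c N‖ * r ^ N := by
      intro N w hw
      rw [mem_ball_zero_iff] at hw
      rw [norm_mul, norm_pow]
      gcongr
    refine ⟨(Complex.differentiableOn_tsum_of_summable_norm (hc r hr h2) hd hU hb).differentiableAt
      (hU.mem_nhds hzU), ?_⟩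
    have := Complex.hasSum_deriv_of_summable_norm (hc r hr h2) hd hU hb hzU
    simpa using! this
  exact ⟨fun z hz => (key z hz).1.differentiableWithinAt, fun z hz => (key z hz).2⟩

/-- Monomials are eigenvectors of `z d/dz + β`. Only agreement on the open disc is assumed, since
that already determines the derivative there. -/
theorem PSConv.eqOn_eulerConj {c : ℕ → ℂ} {R : ℝ} (hc : PSConv c R) (β : ℂ) {f : ℂ → ℂ}
    (hf : Set.EqOn f (psum c) (Metric.ball 0 R)) :
    Set.EqOn (eulerConj β f) (psum fun N => ((N : ℂ) + β) * c N) (Metric.ball 0 R) := by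
  intro z hz
  have h0 : deriv f z = deriv (psum c) z :=
    (hf.eventuallyEq_of_mem (Metric.isOpen_ball.mem_nhds hz)).deriv_eq
  have h1 := (hc.differentiableOn_and_hasSum_deriv.2 z hz).mul_left z
  have h2 := (hc.hasSum (mem_ball_zero_iff.1 hz)).mul_left β
  have h3 := h1.add h2
  rw [eulerConj, h0, hf hz, ← h3.tsum_eq, psum]
  refine tsum_congr fun N => ?_
  rcases N with _ | N
  · simp
  · simp only [Nat.add_sub_cancel, pow_succ]
    ring

theorem PSConv.eqOn_lameDiffOp {g : ℕ → ℂ} {R : ℝ} (hg : PSConv g R) {f : ℂ → ℂ}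
    (a b c q α β : ℂ) (hf : Set.EqOn f (psum g) (Metric.ball 0 R)) :
    PSConv (fun N => ((2 * a - b - c) * (N + β) ^ 2
      + (-(a / 2 ^ 4) * α * (α + 1) + q / 2 ^ 4)) * g N) R ∧
    Set.EqOn (lameDiffOp a b c q α β f) (psum fun N => ((2 * a - b - c) * (N + β) ^ 2
      + (-(a / 2 ^ 4) * α * (α + 1) + q / 2 ^ 4)) * g N) (Metric.ball 0 R) := by
  have e : (fun N : ℕ => ((2 * a - b - c) * (N + β) ^ 2
      + (-(a / 2 ^ 4) * α * (α + 1) + q / 2 ^ 4)) * g N) = fun N : ℕ =>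
      (2 * a - b - c) * ((N + β) * ((N + β) * g N))
        + (-(a / 2 ^ 4) * α * (α + 1) + q / 2 ^ 4) * g N := by
    funext N
    ring
  have h1 := hg.add_mul β
  have h2 := h1.add_mul β
  rw [e]
  refine ⟨(h2.const_mul _).add (hg.const_mul _), fun z hz => ?_⟩
  have hz' := mem_ball_zero_iff.1 hz
  rw [lameDiffOp, h1.eqOn_eulerConj β (hg.eqOn_eulerConj β hf) hz, hf hz]
  rw [psum, psum, ← tsum_mul_left, ← tsum_mul_left,
    ← ((h2.hasSum hz').mul_left _).summable.tsum_add ((hg.hasSum hz').mul_left _).summable, psum]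
  refine tsum_congr fun N => ?_
  ring

/-! ### Summability from recursive inequalities -/

/-- Summing the inequality over a window starting at `M` gives `(1 - θ) S ≤ x M + ∑ e` for every
partial sum `S`. -/
theorem summable_of_eventually_le_add_mul {x e : ℕ → ℝ} {θ : ℝ} (hx : ∀ m, 0 ≤ x m)
    (he : ∀ m, 0 ≤ e m) (hsum : Summable e) (hθ : θ < 1)
    (hrec : ∀ᶠ m in atTop, x (m + 1) ≤ e m + θ * x m) : Summable x := by
  obtain ⟨M, hM⟩ := eventually_atTop.1 hrec
  rw [← summable_nat_add_iff M]
  refine summable_of_sum_range_le (c := (x M + ∑' m, e m) / (1 - θ)) (fun m => hx _) fun n => ?_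
  rw [le_div_iff₀ (by linarith)]
  have h1 : ∑ k ∈ Finset.range n, x (k + M) ≤ ∑ k ∈ Finset.range (n + 1), x (k + M) :=
    Finset.sum_le_sum_of_subset_of_nonneg (Finset.range_mono n.le_succ) fun _ _ _ => hx _
  rw [Finset.sum_range_succ'] at h1
  have h2 : ∑ k ∈ Finset.range n, x (k + 1 + M)
      ≤ ∑ k ∈ Finset.range n, (e (k + M) + θ * x (k + M)) := by
    refine Finset.sum_le_sum fun k _ => ?_
    have := hM (k + M) (by omega)
    rwa [show k + M + 1 = k + 1 + M by ring] at this
  rw [Finset.sum_add_distrib, ← Finset.mul_sum] at h2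
  have h3 : ∑ k ∈ Finset.range n, e (k + M) ≤ ∑' m, e m := by
    refine (((summable_nat_add_iff M).2 hsum).sum_le_tsum _ fun _ _ => he _).trans ?_
    rw [← hsum.sum_add_tsum_nat_add M]
    exact le_add_of_nonneg_left (Finset.sum_nonneg fun _ _ => he _)
  simp only [zero_add] at h1
  linarith

theorem summable_mul_pow_of_le_add_mul {x e ρ : ℕ → ℝ} {r : ℝ} (h0 : 0 ≤ r) (h1 : r < 1)
    (hx : ∀ m, 0 ≤ x m) (he : ∀ m, 0 ≤ e m) (hsum : Summable fun m => e m * r ^ m)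
    (hρ : Tendsto ρ atTop (𝓝 1)) (hrec : ∀ m, x (m + 1) ≤ e (m + 1) + ρ m * x m) :
    Summable fun m => x m * r ^ m := by
  obtain ⟨θ, h2, h3⟩ := exists_between h1
  have h4 : ∀ᶠ m in atTop, ρ m * r < θ :=
    (hρ.mul_const r).eventually_lt_const (by simpa using h2)
  refine summable_of_eventually_le_add_mul (fun m => by have := hx m; positivity)
    (fun m => by have := he (m + 1); positivity) ((summable_nat_add_iff 1).2 hsum) h3 ?_
  filter_upwards [h4] with m hm
  have h5 := mul_le_mul_of_nonneg_right (hrec m) (pow_nonneg h0 (m + 1))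
  have h6 := mul_le_mul_of_nonneg_right hm.le (mul_nonneg (hx m) (pow_nonneg h0 m))
  calc _ ≤ _ := h5
    _ = e (m + 1) * r ^ (m + 1) + ρ m * r * (x m * r ^ m) := by ring
    _ ≤ _ := by gcongr

/-! ### The contour integral -/

theorem hasSum_circleIntegral {ι : Type*} [Countable ι] {F : ι → ℂ → ℂ} {f : ℂ → ℂ} {u : ι → ℝ}
    {r : ℝ} (hr : 0 ≤ r) (hF : ∀ i, ContinuousOn (F i) (Metric.sphere 0 r)) (hu : Summable u)
    (hb : ∀ i, ∀ v ∈ Metric.sphere (0 : ℂ) r, ‖F i v‖ ≤ u i)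
    (hs : ∀ v ∈ Metric.sphere (0 : ℂ) r, HasSum (fun i => F i v) (f v)) :
    HasSum (fun i => ∮ v in C(0, r), F i v) (∮ v in C(0, r), f v) := by
  refine intervalIntegral.hasSum_integral_of_dominated_convergence (fun i _ => r * u i)
    (fun i => ?_) (fun i => ?_) ?_ ?_ ?_
  · have h := (hF i).circleIntegrable hr
    exact (intervalIntegrable_iff.1 h.out).aestronglyMeasurable
  · refine Eventually.of_forall fun t _ => ?_
    rw [norm_smul, deriv_circleMap, norm_mul, norm_circleMap_zero, Complex.norm_I, mul_one,
      abs_of_nonneg hr]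
    exact mul_le_mul_of_nonneg_left (hb i _ (circleMap_mem_sphere 0 hr t)) hr
  · exact Eventually.of_forall fun t _ => hu.mul_left r
  · exact intervalIntegrable_const
  · exact Eventually.of_forall fun t _ => (hs _ (circleMap_mem_sphere 0 hr t)).const_smul _

theorem hasSum_one_sub_cpow_neg (Q : ℂ) {x : ℂ} (hx : ‖x‖ < 1) :
    HasSum (fun k : ℕ => (ascPochhammer ℂ k).eval Q / k.factorial * x ^ k) ((1 - x) ^ (-Q)) := by
  have h := (Complex.one_div_one_sub_cpow_hasFPowerSeriesOnBall_zero Q).hasSum (y := x)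
    (by rw [Metric.mem_eball, edist_zero_right, ← ofReal_norm, ENNReal.ofReal_lt_one]; exact hx)
  rw [zero_add, one_div, ← Complex.cpow_neg] at h
  refine (hasSum_congr fun k => ?_).1 h
  have h1 := Ring.factorial_nsmul_multichoose_eq_ascPochhammer Q k
  rw [Polynomial.ascPochhammer_smeval_eq_eval, nsmul_eq_mul, Ring.multichoose_eq] at h1
  have h2 : (k.factorial : ℂ) ≠ 0 := by exact_mod_cast k.factorial_ne_zero
  simp [FormalMultilinearSeries.ofScalars, ← h1, h2]

theorem psConv_ascPochhammer_div_factorial (Q : ℂ) :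
    PSConv (fun k => (ascPochhammer ℂ k).eval Q / k.factorial) 1 := fun r h0 hr => by
  have h := (hasSum_one_sub_cpow_neg Q (x := (r : ℂ)) (by simpa [abs_of_nonneg h0])).summable.norm
  simpa [abs_of_nonneg h0] using h

theorem circleIntegral_zpow {r : ℝ} (hr : r ≠ 0) (n : ℤ) :
    (∮ v in C(0, r), v ^ n) = if n = -1 then 2 * Real.pi * Complex.I else 0 := by
  split_ifs with h
  · subst h
    simpa using circleIntegral.integral_sub_center_inv 0 hr
  · simpa using circleIntegral.integral_sub_zpow_of_ne h 0 0 r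

/-- On this circle `|1/v| < 1` and `|X v| < 1`, so both powers have absolutely convergent binomial
series, in `1/v` and in `X v`. The factor `1/v` makes the integral extract the constant term of
their product, where the two exponents agree. -/
theorem hasSum_circleIntegral_kernel (P Q X : ℂ) {r : ℝ} (h1 : 1 < r) (hX : ‖X‖ * r < 1) :
    HasSum (fun i : ℕ => (ascPochhammer ℂ i).eval P / i.factorial *
        ((ascPochhammer ℂ i).eval Q / i.factorial) * X ^ i)
      (1 / (2 * Real.pi * Complex.I) *
        ∮ v in C(0, r), 1 / v * ((v - 1) / v) ^ (-P) * (1 - X * v) ^ (-Q)) := by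
  have hr : 0 < r := by linarith
  set p : ℕ → ℂ := fun i => (ascPochhammer ℂ i).eval P / i.factorial with hp
  set q : ℕ → ℂ := fun i => (ascPochhammer ℂ i).eval Q / i.factorial with hq
  have hps : Summable fun i => ‖p i‖ * r⁻¹ ^ i :=
    psConv_ascPochhammer_div_factorial P _ (by positivity) (inv_lt_one_of_one_lt₀ h1)
  have hqs : Summable fun i => ‖q i‖ * (‖X‖ * r) ^ i :=
    psConv_ascPochhammer_div_factorial Q _ (by positivity) hX
  have hv0 : ∀ v ∈ Metric.sphere (0 : ℂ) r, v ≠ 0 := fun v hv => by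
    rw [mem_sphere_zero_iff_norm] at hv
    exact norm_pos_iff.1 (hv ▸ hr)
  have key := hasSum_circleIntegral (ι := ℕ × ℕ) (r := r)
    (F := fun k v => 1 / v * (p k.1 * v⁻¹ ^ k.1 * (q k.2 * (X * v) ^ k.2)))
    (f := fun v => 1 / v * ((v - 1) / v) ^ (-P) * (1 - X * v) ^ (-Q))
    (u := fun k => r⁻¹ * (‖p k.1‖ * r⁻¹ ^ k.1 * (‖q k.2‖ * (‖X‖ * r) ^ k.2))) hr.le
    (fun k => by
      have := hv0
      have h2 : ContinuousOn (fun v : ℂ => v⁻¹) (Metric.sphere 0 r) := continuousOn_id.inv₀ hv0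
      simp only [one_div]
      fun_prop)
    ((hps.mul_of_nonneg hqs (fun _ => by positivity) (fun _ => by positivity)).mul_left _)
    (fun k v hv => by
      rw [mem_sphere_zero_iff_norm] at hv
      simp [hv])
    (fun v hv => by
      have h0 := hv0 v hv
      rw [mem_sphere_zero_iff_norm] at hv
      have e1 : HasSum (fun i => p i * v⁻¹ ^ i) (((v - 1) / v) ^ (-P)) := by
        rw [show (v - 1) / v = 1 - v⁻¹ by field_simp]
        exact hasSum_one_sub_cpow_neg P (by rw [norm_inv, hv]; exact inv_lt_one_of_one_lt₀ h1)
      have e2 : HasSum (fun i => q i * (X * v) ^ i) ((1 - X * v) ^ (-Q)) :=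
        hasSum_one_sub_cpow_neg Q (by rwa [norm_mul, hv])
      rw [mul_assoc]
      refine (e1.mul e2 ?_).mul_left (1 / v)
      refine Summable.of_norm ?_
      have := hps.mul_of_nonneg hqs (fun _ => by positivity) (fun _ => by positivity)
      simpa [hv] using this)
  have key2 := key.mul_left (1 / (2 * Real.pi * Complex.I))
  have hval : ∀ k : ℕ × ℕ, 1 / (2 * Real.pi * Complex.I) *
      (∮ v in C(0, r), 1 / v * (p k.1 * v⁻¹ ^ k.1 * (q k.2 * (X * v) ^ k.2)))
      = if k.1 = k.2 then p k.1 * q k.2 * X ^ k.2 else 0 := by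
    intro k
    have e : (∮ v in C(0, r), 1 / v * (p k.1 * v⁻¹ ^ k.1 * (q k.2 * (X * v) ^ k.2)))
        = ∮ v in C(0, r), (p k.1 * q k.2 * X ^ k.2) * v ^ ((k.2 : ℤ) - k.1 - 1) := by
      refine circleIntegral.integral_congr hr.le fun v hv => ?_
      have h0 := hv0 v hv
      simp only [zpow_sub₀ h0, zpow_natCast, zpow_one, mul_pow, inv_pow]
      field_simp
    rw [e, circleIntegral.integral_const_mul, circleIntegral_zpow hr.ne']
    have hpi : (2 * Real.pi * Complex.I : ℂ) ≠ 0 := Complex.two_pi_I_ne_zero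
    by_cases hk : k.1 = k.2
    · rw [if_pos (by omega), if_pos hk]
      field_simp
    · rw [if_neg (by omega), if_neg hk]
      simp
  simp only [hval] at key2
  -- The double series is supported on the diagonal, so it may be reindexed by a single exponent.
  have hinj : Function.Injective fun i : ℕ => (i, i) := fun i j h => (Prod.ext_iff.1 h).1
  rw [← hinj.hasSum_iff] at key2
  · simpa [Function.comp_def] using key2
  · rintro ⟨i, j⟩ hij
    refine if_neg fun h => hij ⟨i, ?_⟩
    simp only at h
    rw [h]

theorem one_sub_ne_zero_of_norm_lt_one {x : ℂ} (hx : ‖x‖ < 1) : 1 - x ≠ 0 := fun h => by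
  rw [← sub_eq_zero.1 h] at hx
  simp at hx

theorem one_sub_mem_slitPlane {x : ℂ} (hx : ‖x‖ < 1) : 1 - x ∈ Complex.slitPlane := by
  refine Or.inl ?_
  have := (Complex.abs_re_le_norm x).trans_lt hx
  have := (abs_lt.1 this).2
  simp only [Complex.sub_re, Complex.one_re]
  linarith

section Circle

variable {w : ℂ} {t u r : ℝ}

theorem AdmissibleRadius.norm_mul_lt (hr : AdmissibleRadius w t u r) (ht : t ∈ Set.Ioo (0 : ℝ) 1)
    (hu : u ∈ Set.Ioo (0 : ℝ) 1) : ‖w * (1 - t) * (1 - u)‖ * r < 1 := by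
  have h1 : ‖(1 - t : ℂ)‖ = 1 - t := by
    rw [← Complex.ofReal_one, ← Complex.ofReal_sub, Complex.norm_real, Real.norm_of_nonneg]
    linarith [ht.2]
  have h2 : ‖(1 - u : ℂ)‖ = 1 - u := by
    rw [← Complex.ofReal_one, ← Complex.ofReal_sub, Complex.norm_real, Real.norm_of_nonneg]
    linarith [hu.2]
  rw [norm_mul, norm_mul, h1, h2, mul_assoc ‖w‖]
  exact hr.2.1

/-- Both bases have the form `1 - x` with `|x| < 1`, hence positive real part: the principal powers
are continuous along the circle and given by their binomial series. -/
theorem AdmissibleRadius.facts (hr : AdmissibleRadius w t u r) (ht : t ∈ Set.Ioo (0 : ℝ) 1)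
    (hu : u ∈ Set.Ioo (0 : ℝ) 1) {v : ℂ} (hv : v ∈ Metric.sphere (0 : ℂ) r) :
    v ≠ 0 ∧ v - 1 ≠ 0 ∧ (v - 1) / v ∈ Complex.slitPlane ∧
      1 - w * v * (1 - t) * (1 - u) ∈ Complex.slitPlane := by
  rw [mem_sphere_zero_iff_norm] at hv
  have h0 : v ≠ 0 := norm_pos_iff.1 (by linarith [hr.1])
  have h1 : ‖v⁻¹‖ < 1 := by
    rw [norm_inv, hv]
    exact inv_lt_one_of_one_lt₀ hr.1
  have h2 : (v - 1) / v = 1 - v⁻¹ := by field_simp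
  refine ⟨h0, fun h => ?_, ?_, ?_⟩
  · have := one_sub_ne_zero_of_norm_lt_one h1
    rw [← h2, h, zero_div] at this
    exact this rfl
  · rw [h2]
    exact one_sub_mem_slitPlane h1
  · refine one_sub_mem_slitPlane ?_
    rw [show w * v * (1 - t) * (1 - u) = w * (1 - t) * (1 - u) * v by ring, norm_mul, hv]
    exact hr.norm_mul_lt ht hu

theorem AdmissibleRadius.continuousOn_lameW (hr : AdmissibleRadius w t u r)
    (ht : t ∈ Set.Ioo (0 : ℝ) 1) (hu : u ∈ Set.Ioo (0 : ℝ) 1) :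
    ContinuousOn (lameW w t u) (Metric.sphere 0 r) := by
  have h1 : ∀ v ∈ Metric.sphere (0 : ℂ) r, v - 1 ≠ 0 := fun v hv => (hr.facts ht hu hv).2.1
  have h2 : ∀ v ∈ Metric.sphere (0 : ℂ) r, 1 - w * v * (1 - t) * (1 - u) ≠ 0 :=
    fun v hv => Complex.slitPlane_ne_zero (hr.facts ht hu hv).2.2.2
  unfold lameW
  exact (continuousOn_const.div (by fun_prop) h1).mul
    ((by fun_prop : ContinuousOn _ _).div (by fun_prop) h2)

theorem AdmissibleRadius.continuousOn_kernel (hr : AdmissibleRadius w t u r)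
    (ht : t ∈ Set.Ioo (0 : ℝ) 1) (hu : u ∈ Set.Ioo (0 : ℝ) 1) (P Q : ℂ) :
    ContinuousOn (fun v : ℂ => 1 / v * ((v - 1) / v) ^ P * (1 - w * v * (1 - t) * (1 - u)) ^ Q)
      (Metric.sphere 0 r) := by
  have h0 : ∀ v ∈ Metric.sphere (0 : ℂ) r, v ≠ 0 := fun v hv => (hr.facts ht hu hv).1
  refine ((continuousOn_const.div continuousOn_id h0).mul (ContinuousOn.cpow_const ?_ ?_)).mul
    (ContinuousOn.cpow_const ?_ ?_)
  · exact (by fun_prop : ContinuousOn (fun v : ℂ => v - 1) _).div continuousOn_id h0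
  · exact fun v hv => (hr.facts ht hu hv).2.2.1
  · fun_prop
  · exact fun v hv => (hr.facts ht hu hv).2.2.2

/-- `W` is `w t u` divided by exactly the two bases of the kernel, so `W ^ j` shifts `P` and `Q` by
`j`. The shift is an integer, so no branch condition arises. -/
theorem AdmissibleRadius.kernel_mul_lameW_pow (hr : AdmissibleRadius w t u r)
    (ht : t ∈ Set.Ioo (0 : ℝ) 1) (hu : u ∈ Set.Ioo (0 : ℝ) 1) (P Q : ℂ) (j : ℕ) {v : ℂ}
    (hv : v ∈ Metric.sphere (0 : ℂ) r) :
    1 / v * ((v - 1) / v) ^ (-P) * (1 - w * v * (1 - t) * (1 - u)) ^ (-Q) * lameW w t u v ^ j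
      = (w * t * u) ^ j * (1 / v * ((v - 1) / v) ^ (-(P + j)) *
        (1 - w * (1 - t) * (1 - u) * v) ^ (-(Q + j))) := by
  obtain ⟨h0, h1, h2, h3⟩ := hr.facts ht hu hv
  have h2' := Complex.slitPlane_ne_zero h2
  have h3' := Complex.slitPlane_ne_zero h3
  rw [show w * (1 - t) * (1 - u) * v = w * v * (1 - t) * (1 - u) by ring]
  rw [neg_add, neg_add, ← sub_eq_add_neg, ← sub_eq_add_neg, Complex.cpow_sub _ _ h2',
    Complex.cpow_sub _ _ h3', Complex.cpow_natCast, Complex.cpow_natCast, lameW]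
  set x := ((v - 1) / v) ^ (-P)
  set y := (1 - w * v * (1 - t) * (1 - u)) ^ (-Q)
  set z := 1 - w * v * (1 - t) * (1 - u)
  simp only [div_pow, mul_pow, one_pow]
  field_simp

/-- The contour integral of the kernel times a power series in `W`, term by term. -/
theorem AdmissibleRadius.hasSum_contour (hr : AdmissibleRadius w t u r)
    (ht : t ∈ Set.Ioo (0 : ℝ) 1) (hu : u ∈ Set.Ioo (0 : ℝ) 1) (P Q : ℂ) {h : ℕ → ℂ} {H : ℂ → ℂ}
    (hh : PSConv h 1) (hH : Set.EqOn H (psum h) (Metric.ball 0 1)) :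
    CircleIntegrable (fun v => 1 / v * ((v - 1) / v) ^ (-P) *
      (1 - w * v * (1 - t) * (1 - u)) ^ (-Q) * H (lameW w t u v)) 0 r ∧
    HasSum (fun j : ℕ => h j * (w * t * u) ^ j * ∑' i : ℕ,
        (ascPochhammer ℂ i).eval (P + j) / i.factorial *
        ((ascPochhammer ℂ i).eval (Q + j) / i.factorial) * (w * (1 - t) * (1 - u)) ^ i)
      (1 / (2 * Real.pi * Complex.I) * ∮ v in C(0, r), 1 / v * ((v - 1) / v) ^ (-P) *
      (1 - w * v * (1 - t) * (1 - u)) ^ (-Q) * H (lameW w t u v)) := by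
  have hr0 : 0 ≤ r := by linarith [hr.1]
  have hWc := hr.continuousOn_lameW ht hu
  have hKc := hr.continuousOn_kernel ht hu (-P) (-Q)
  have hmaps : Set.MapsTo (lameW w t u) (Metric.sphere 0 r) (Metric.ball 0 1) := fun v hv => by
    simpa using hr.2.2 v (by simpa using hv)
  have hne : (Metric.sphere (0 : ℂ) r).Nonempty := NormedSpace.sphere_nonempty.2 hr0
  -- Compactness gives a maximum of `|W|` strictly below 1 and a bound on the kernel; together they
  -- dominate the series in `W` uniformly on the circle.
  obtain ⟨v₁, hv₁, hmax₁⟩ := (isCompact_sphere (0 : ℂ) r).exists_isMaxOn hne hWc.norm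
  obtain ⟨v₂, hv₂, hmax₂⟩ := (isCompact_sphere (0 : ℂ) r).exists_isMaxOn hne hKc.norm
  have hθ : ‖lameW w t u v₁‖ < 1 := by simpa using hmaps hv₁
  have hHc : ContinuousOn H (Metric.ball 0 1) :=
    hh.differentiableOn_and_hasSum_deriv.1.continuousOn.congr hH
  refine ⟨(hKc.mul (hHc.comp hWc hmaps)).circleIntegrable hr0, ?_⟩
  have key := hasSum_circleIntegral (ι := ℕ) (r := r)
    (F := fun j v => h j * (1 / v * ((v - 1) / v) ^ (-P) *
      (1 - w * v * (1 - t) * (1 - u)) ^ (-Q) * lameW w t u v ^ j))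
    (f := fun v => 1 / v * ((v - 1) / v) ^ (-P) *
      (1 - w * v * (1 - t) * (1 - u)) ^ (-Q) * H (lameW w t u v))
    hr0 (fun j => continuousOn_const.mul (hKc.mul (hWc.pow j)))
    ((hh _ (norm_nonneg _) hθ).mul_left
      ‖1 / v₂ * ((v₂ - 1) / v₂) ^ (-P) * (1 - w * v₂ * (1 - t) * (1 - u)) ^ (-Q)‖)
    (fun j v hv => by
      rw [norm_mul, norm_mul _ (lameW w t u v ^ j), norm_pow, mul_left_comm]
      gcongr
      · exact hmax₂ hv
      · exact hmax₁ hv)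
    (fun v hv => by
      have h1 := hmaps hv
      rw [hH h1]
      have h2 := (hh.hasSum (mem_ball_zero_iff.1 h1)).mul_left
        (1 / v * ((v - 1) / v) ^ (-P) * (1 - w * v * (1 - t) * (1 - u)) ^ (-Q))
      exact (hasSum_congr fun j => by ring).1 h2)
  have key2 := key.mul_left (1 / (2 * Real.pi * Complex.I))
  refine (hasSum_congr fun j => ?_).1 key2
  have hk := hasSum_circleIntegral_kernel (P + j) (Q + j) (w * (1 - t) * (1 - u)) hr.1
    (hr.norm_mul_lt ht hu)
  rw [hk.tsum_eq, circleIntegral.integral_const_mul, circleIntegral.integral_congr hr0 fun v hv =>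
    hr.kernel_mul_lameW_pow ht hu P Q j hv,
    circleIntegral.integral_const_mul]
  ring

end Circle

/-- With `κ² = |w| (1-t)(1-u)`, the triangle inequality bounds `|W|` on `|v| = r` by `|w| t u r /
((r-1)(1-κ² r))`. The choice `r = 1/κ` minimises this bound, to `|w| t u / (1-κ)²`. It is below 1
because `√(tu)` and `√((1-t)(1-u))` are at most the arithmetic means `(t+u)/2` and `1-(t+u)/2`,
which sum to 1. -/
theorem exists_admissibleRadius {w : ℂ} (hw : ‖w‖ < 1) {t u : ℝ} (ht : t ∈ Set.Ioo (0 : ℝ) 1)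
    (hu : u ∈ Set.Ioo (0 : ℝ) 1) : ∃ r, AdmissibleRadius w t u r := by
  obtain ⟨ht0, ht1⟩ := ht
  obtain ⟨hu0, hu1⟩ := hu
  have hT : 0 < (1 - t) * (1 - u) := mul_pos (by linarith) (by linarith)
  have hT1 : (1 - t) * (1 - u) < 1 := by nlinarith
  -- For `w = 0` the optimal radius `1/κ` degenerates, but then `W = 0` and any `r > 1` works.
  rcases eq_or_ne w 0 with rfl | hw0
  · refine ⟨2, by norm_num, by simp, fun v _ => by simp [lameW]⟩
  have hω : 0 < ‖w‖ := norm_pos_iff.2 hw0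
  set κ := Real.sqrt (‖w‖ * ((1 - t) * (1 - u))) with hκ
  have hκ0 : 0 < κ := Real.sqrt_pos.2 (by positivity)
  have hκ2 : κ ^ 2 = ‖w‖ * ((1 - t) * (1 - u)) := Real.sq_sqrt (by positivity)
  have hκ1 : κ < 1 := by nlinarith
  have hmain : ‖w‖ * t * u < (1 - κ) ^ 2 := by
    have h1 : κ ≤ Real.sqrt ‖w‖ * (1 - (t + u) / 2) := by
      rw [hκ]
      apply Real.sqrt_le_iff.2
      refine ⟨by have := Real.sqrt_nonneg ‖w‖; apply mul_nonneg this; linarith, ?_⟩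
      rw [mul_pow, Real.sq_sqrt hω.le]
      gcongr
      nlinarith [sq_nonneg (t - u)]
    have hs0 := Real.sqrt_pos.2 hω
    have hs1 : Real.sqrt ‖w‖ < 1 := by rw [Real.sqrt_lt' one_pos]; simpa
    have h2 : Real.sqrt ‖w‖ * ((t + u) / 2) < 1 - κ := by linarith
    have h3 : (Real.sqrt ‖w‖ * ((t + u) / 2)) ^ 2 < (1 - κ) ^ 2 := by
      have : 0 ≤ Real.sqrt ‖w‖ * ((t + u) / 2) := by positivity
      gcongr
    refine lt_of_le_of_lt ?_ h3
    rw [mul_pow, Real.sq_sqrt hω.le, mul_assoc]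
    gcongr
    nlinarith [sq_nonneg (t - u)]
  refine ⟨κ⁻¹, one_lt_inv_iff₀.2 ⟨hκ0, hκ1⟩, ?_, fun v hv => ?_⟩
  · rw [← hκ2]
    field_simp
    exact hκ1
  · have h1 : κ⁻¹ - 1 ≤ ‖v - 1‖ := by
      have := norm_sub_norm_le v 1
      rwa [hv, norm_one] at this
    have h2 : 1 - κ ≤ ‖1 - w * v * (1 - t) * (1 - u)‖ := by
      have := norm_sub_norm_le 1 (w * v * (1 - t) * (1 - u))
      rw [norm_one] at this
      refine le_trans (le_of_eq ?_) this
      have e1 : ‖(1 - t : ℂ)‖ = 1 - t := by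
        rw [← Complex.ofReal_one, ← Complex.ofReal_sub, Complex.norm_real, Real.norm_of_nonneg]
        linarith
      have e2 : ‖(1 - u : ℂ)‖ = 1 - u := by
        rw [← Complex.ofReal_one, ← Complex.ofReal_sub, Complex.norm_real, Real.norm_of_nonneg]
        linarith
      rw [norm_mul, norm_mul, norm_mul, e1, e2, hv]
      have : ‖w‖ * κ⁻¹ * (1 - t) * (1 - u) = κ ^ 2 * κ⁻¹ := by rw [hκ2]; ring
      rw [this]
      field_simp
    have h3 : 0 < κ⁻¹ - 1 := sub_pos.2 (one_lt_inv_iff₀.2 ⟨hκ0, hκ1⟩)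
    have h4 : 0 < 1 - κ := by linarith
    rw [lameW, norm_mul, norm_div, norm_div, norm_one, norm_mul, norm_mul, norm_mul, hv,
      Complex.norm_real, Complex.norm_real, Real.norm_of_nonneg ht0.le, Real.norm_of_nonneg hu0.le]
    calc _ ≤ 1 / (κ⁻¹ - 1) * (‖w‖ * κ⁻¹ * t * u / (1 - κ)) := by gcongr
      _ = ‖w‖ * t * u / (1 - κ) ^ 2 := by
        have : κ⁻¹ - 1 = (1 - κ) / κ := by field_simp
        rw [this]
        field_simp
      _ < 1 := by
        rw [div_lt_one (by positivity)]
        exact hmain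

/-! ### The coefficients produced by one integral operator -/

theorem ascPochhammer_eval_eq_prod_range (z : ℂ) (n : ℕ) :
    (ascPochhammer ℂ n).eval z = ∏ k ∈ Finset.range n, (z + k) := by
  induction n with
  | zero => simp
  | succ n ih => rw [ascPochhammer_succ_eval, ih, Finset.prod_range_succ]

theorem norm_ofReal_add_natCast {x : ℝ} (hx : 0 < x) (j : ℕ) : ‖(x : ℂ) + j‖ = x + j := by
  rw [← Complex.ofReal_natCast, ← Complex.ofReal_add, Complex.norm_real,
    Real.norm_of_nonneg (by positivity)]

theorem ofReal_add_natCast_ne_zero {x : ℝ} (hx : 0 < x) (j : ℕ) : (x : ℂ) + j ≠ 0 := by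
  rw [← norm_pos_iff, norm_ofReal_add_natCast hx]
  positivity

theorem ascPochhammer_eval_ofReal_ne_zero {x : ℝ} (hx : 0 < x) (n : ℕ) :
    (ascPochhammer ℂ n).eval (x : ℂ) ≠ 0 := by
  rw [ascPochhammer_eval_eq_prod_range]
  exact Finset.prod_ne_zero_iff.2 fun k _ => ofReal_add_natCast_ne_zero hx k

theorem ascPochhammer_eval_ofReal_add_natCast_ne_zero {x : ℝ} (hx : 0 < x) (j n : ℕ) :
    (ascPochhammer ℂ n).eval ((x : ℂ) + j) ≠ 0 := by
  have := ascPochhammer_eval_ofReal_ne_zero (x := x + j) (by positivity) n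
  simpa using this

/-- The contribution of `W ^ j` to the coefficient of `w ^ (i + j)`. -/
noncomputable def betaCoeff (P Q : ℂ) (x y : ℝ) (j i : ℕ) : ℂ :=
  (ascPochhammer ℂ i).eval (P + j) * (ascPochhammer ℂ i).eval (Q + j) /
    ((ascPochhammer ℂ (i + 1)).eval ((x : ℂ) + j) * (ascPochhammer ℂ (i + 1)).eval ((y : ℂ) + j))

/-- The power series coefficients of the integral operator applied to `∑ h j * w ^ j`. -/
noncomputable def stepCoeff (P Q : ℂ) (x y : ℝ) (h : ℕ → ℂ) (m : ℕ) : ℂ :=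
  ∑ k ∈ Finset.HasAntidiagonal.antidiagonal m, h k.1 * betaCoeff P Q x y k.1 k.2

section

variable {P Q : ℂ} {x y : ℝ} {h : ℕ → ℂ}

theorem betaCoeff_zero (j : ℕ) : betaCoeff P Q x y j 0 = 1 / (((x : ℂ) + j) * ((y : ℂ) + j)) := by
  simp [betaCoeff]

/-- The ratio depends on `j` and `i` only through `j + i`, so it is constant along an antidiagonal.
-/
theorem betaCoeff_succ (j i : ℕ) : betaCoeff P Q x y j (i + 1) =
    (P + (j + i : ℕ)) * (Q + (j + i : ℕ)) /
      ((x + (j + i + 1 : ℕ)) * (y + (j + i + 1 : ℕ))) * betaCoeff P Q x y j i := by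
  rw [betaCoeff, betaCoeff, ascPochhammer_succ_eval (i + 1) ((x : ℂ) + j),
    ascPochhammer_succ_eval (i + 1) ((y : ℂ) + j), ascPochhammer_succ_eval i (P + j),
    ascPochhammer_succ_eval i (Q + j), div_mul_div_comm]
  push_cast
  congr 1 <;> ring

theorem stepCoeff_zero : stepCoeff P Q x y h 0 = h 0 / (x * y) := by
  simp [stepCoeff, betaCoeff_zero, div_eq_mul_inv]

/-- The antidiagonal term with `i = 0` is the new source `h (m + 1)`; the others are those of
`stepCoeff … m`, all multiplied by the common ratio of `betaCoeff_succ`. -/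
theorem stepCoeff_succ (m : ℕ) : stepCoeff P Q x y h (m + 1) =
    (h (m + 1) + (P + m) * (Q + m) * stepCoeff P Q x y h m) /
      ((x + (m + 1 : ℕ)) * (y + (m + 1 : ℕ))) := by
  rw [stepCoeff, Finset.Nat.sum_antidiagonal_succ', betaCoeff_zero, stepCoeff, add_div,
    Finset.mul_sum, Finset.sum_div, mul_one_div]
  congr 1
  refine Finset.sum_congr rfl fun k hk => ?_
  rw [Finset.HasAntidiagonal.mem_antidiagonal] at hk
  rw [betaCoeff_succ, hk]
  ring

theorem tendsto_norm_ratio (P Q : ℂ) (x y : ℝ) :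
    Tendsto (fun m : ℕ => ‖(P + m) * (Q + m) / (((x : ℂ) + (m + 1 : ℕ)) * (y + (m + 1 : ℕ)))‖)
      atTop (𝓝 1) := by
  have h1 := tendsto_add_mul_div_add_mul_atTop_nhds P ((x : ℂ) + 1) 1 one_ne_zero
  have h2 := tendsto_add_mul_div_add_mul_atTop_nhds Q ((y : ℂ) + 1) 1 one_ne_zero
  have h3 := (h1.mul h2).norm
  simp only [one_mul, div_one, mul_one, norm_one] at h3
  refine h3.congr fun m => ?_
  rw [div_mul_div_comm]
  push_cast
  ring_nf

/-- Antidiagonal sums of absolute values satisfy the inequality version of `stepCoeff_succ`, with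
ratio tending to 1. Summability over pairs, not just of `stepCoeff`, is what justifies integrating
the double series term by term. -/
theorem summable_norm_betaCoeff (P Q : ℂ) (hx : 0 < x) (hy : 0 < y) (hh : PSConv h 1) {r : ℝ}
    (h0 : 0 ≤ r) (h1 : r < 1) :
    Summable fun k : ℕ × ℕ => ‖h k.1‖ * ‖betaCoeff P Q x y k.1 k.2‖ * r ^ (k.1 + k.2) := by
  rw [← Finset.HasAntidiagonal.sigmaAntidiagonalEquivProd.summable_iff,
    summable_sigma_of_nonneg fun _ => by simp only [Function.comp]; positivity]
  refine ⟨fun m => (hasSum_fintype _).summable, ?_⟩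
  set X : ℕ → ℝ := fun m =>
    ∑ k ∈ Finset.HasAntidiagonal.antidiagonal m, ‖h k.1‖ * ‖betaCoeff P Q x y k.1 k.2‖ with hX
  have e : ∀ m : ℕ, (∑' k : Finset.HasAntidiagonal.antidiagonal m,
      ((fun k : ℕ × ℕ => ‖h k.1‖ * ‖betaCoeff P Q x y k.1 k.2‖ * r ^ (k.1 + k.2)) ∘
        Finset.HasAntidiagonal.sigmaAntidiagonalEquivProd) ⟨m, k⟩) = X m * r ^ m := by
    intro m
    rw [tsum_fintype, hX, Finset.sum_mul, ← Finset.sum_coe_sort (Finset.HasAntidiagonal.antidiagonal m)]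
    refine Finset.sum_congr rfl fun k _ => ?_
    have := Finset.HasAntidiagonal.mem_antidiagonal.1 k.2
    simp [Finset.HasAntidiagonal.sigmaAntidiagonalEquivProd, this]
  simp only [e]
  refine summable_mul_pow_of_le_add_mul (e := fun m => ‖h m‖ / (x * y)) h0 h1
    (fun m => by positivity) (fun m => by positivity) ?_ (tendsto_norm_ratio P Q x y)
    fun m => ?_
  · refine ((hh r h0 h1).div_const (x * y)).congr fun m => by ring
  · rw [hX]
    simp only
    rw [Finset.Nat.sum_antidiagonal_succ', Finset.mul_sum]
    refine add_le_add ?_ (Finset.sum_le_sum fun k hk => ?_)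
    · rw [betaCoeff_zero, norm_div, norm_one, norm_mul, norm_ofReal_add_natCast hx,
        norm_ofReal_add_natCast hy, mul_one_div]
      have : (0 : ℝ) ≤ (m + 1 : ℕ) := Nat.cast_nonneg _
      gcongr <;> linarith
    · rw [Finset.HasAntidiagonal.mem_antidiagonal] at hk
      rw [betaCoeff_succ, hk, norm_mul]
      exact le_of_eq (by ring)

theorem psConv_stepCoeff (P Q : ℂ) (hx : 0 < x) (hy : 0 < y) (hh : PSConv h 1) :
    PSConv (stepCoeff P Q x y h) 1 := by
  intro r h0 h1
  have h2 := summable_norm_betaCoeff P Q hx hy hh h0 h1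
  rw [← Finset.HasAntidiagonal.sigmaAntidiagonalEquivProd.summable_iff] at h2
  refine h2.sigma.of_nonneg_of_le (fun _ => by positivity) fun m => ?_
  rw [tsum_fintype, stepCoeff]
  refine (mul_le_mul_of_nonneg_right (norm_sum_le _ _) (by positivity)).trans ?_
  rw [Finset.sum_mul, ← Finset.sum_coe_sort (Finset.HasAntidiagonal.antidiagonal m)]
  refine Finset.sum_le_sum fun k _ => ?_
  have := Finset.HasAntidiagonal.mem_antidiagonal.1 k.2
  simp [Finset.HasAntidiagonal.sigmaAntidiagonalEquivProd, this]

theorem hasSum_betaCoeff (P Q : ℂ) (hx : 0 < x) (hy : 0 < y) (hh : PSConv h 1) {w : ℂ}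
    (hw : ‖w‖ < 1) :
    HasSum (fun k : ℕ × ℕ => h k.1 * betaCoeff P Q x y k.1 k.2 * w ^ (k.1 + k.2))
      (psum (stepCoeff P Q x y h) w) := by
  have h1 : Summable fun k : ℕ × ℕ => h k.1 * betaCoeff P Q x y k.1 k.2 * w ^ (k.1 + k.2) := by
    refine Summable.of_norm ?_
    simpa using summable_norm_betaCoeff P Q hx hy hh (norm_nonneg w) hw
  have h2 := (Finset.HasAntidiagonal.sigmaAntidiagonalEquivProd.hasSum_iff.2 h1.hasSum).sigma
    fun m => hasSum_fintype _
  have h3 := (psConv_stepCoeff P Q hx hy hh).hasSum hw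
  rw [h3.unique (f := fun N => stepCoeff P Q x y h N * w ^ N) ?_]
  · exact h1.hasSum
  · refine (hasSum_congr fun m => ?_).1 h2
    rw [stepCoeff, Finset.sum_mul, ← Finset.sum_coe_sort (Finset.HasAntidiagonal.antidiagonal m)]
    refine Finset.sum_congr rfl fun k _ => ?_
    have := Finset.HasAntidiagonal.mem_antidiagonal.1 k.2
    simp [Finset.HasAntidiagonal.sigmaAntidiagonalEquivProd, this]

end

/-! ### Beta integrals -/

theorem betaKernel_eq_ofReal {x t : ℝ} (ht : 0 < t) (j i : ℕ) :
    (t : ℂ) ^ ((x : ℂ) - 1) * ((t : ℂ) ^ j * (1 - (t : ℂ)) ^ i)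
      = ((t ^ (x - 1) * (t ^ j * (1 - t) ^ i) : ℝ) : ℂ) := by
  push_cast
  rw [Complex.ofReal_cpow ht.le]
  push_cast
  rfl

/-- This is Euler's integral `B(x + j, i + 1)`, whose integer second argument turns the Gamma
quotient into a Pochhammer product. -/
theorem integrableOn_betaKernel {x : ℝ} (hx : 0 < x) (j i : ℕ) :
    IntegrableOn (fun t : ℝ => (t : ℂ) ^ ((x : ℂ) - 1) * ((t : ℂ) ^ j * (1 - (t : ℂ)) ^ i))
      (Set.Ioo 0 1) ∧
    ∫ t in Set.Ioo (0 : ℝ) 1, (t : ℂ) ^ ((x : ℂ) - 1) * ((t : ℂ) ^ j * (1 - (t : ℂ)) ^ i)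
      = i.factorial / (ascPochhammer ℂ (i + 1)).eval ((x : ℂ) + j) := by
  have hu : 0 < ((x : ℂ) + j).re := by
    simp only [Complex.add_re, Complex.ofReal_re, Complex.natCast_re]
    positivity
  have hv : 0 < ((i : ℂ) + 1).re := by
    simp only [Complex.add_re, Complex.natCast_re, Complex.one_re]
    positivity
  have e : Set.EqOn (fun t : ℝ => (t : ℂ) ^ ((x : ℂ) + j - 1) * (1 - (t : ℂ)) ^ ((i : ℂ) + 1 - 1))
      (fun t : ℝ => (t : ℂ) ^ ((x : ℂ) - 1) * ((t : ℂ) ^ j * (1 - (t : ℂ)) ^ i))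
      (Set.Ioo 0 1) := fun t ht => by
    have h0 : (t : ℂ) ≠ 0 := by exact_mod_cast ht.1.ne'
    simp only [add_sub_cancel_right, Complex.cpow_natCast]
    rw [show (x : ℂ) + j - 1 = (x - 1) + j by ring, Complex.cpow_add _ _ h0, Complex.cpow_natCast]
    ring
  have h1 := Complex.betaIntegral_convergent hu hv
  have h2 := Complex.betaIntegral_eval_nat_add_one_right hu i
  rw [Complex.betaIntegral, intervalIntegral.integral_of_le zero_le_one,
    integral_Ioc_eq_integral_Ioo, setIntegral_congr_fun measurableSet_Ioo e] at h2
  rw [intervalIntegrable_iff_integrableOn_Ioo_of_le zero_le_one] at h1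
  refine ⟨h1.congr_fun e measurableSet_Ioo, ?_⟩
  rw [h2, ascPochhammer_eval_eq_prod_range]

/-- For real `x` the kernel is nonnegative, so the norm passes through the integral without loss. -/
theorem integral_norm_betaKernel {x : ℝ} (hx : 0 < x) (j i : ℕ) :
    ∫ t in Set.Ioo (0 : ℝ) 1, ‖(t : ℂ) ^ ((x : ℂ) - 1) * ((t : ℂ) ^ j * (1 - (t : ℂ)) ^ i)‖
      = ‖(i.factorial : ℂ) / (ascPochhammer ℂ (i + 1)).eval ((x : ℂ) + j)‖ := by
  have h1 := (integrableOn_betaKernel hx j i).2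
  have h2 : ∀ t ∈ Set.Ioo (0 : ℝ) 1, 0 ≤ t ^ (x - 1) * (t ^ j * (1 - t) ^ i) := fun t ht => by
    have := sub_nonneg.2 ht.2.le
    have := ht.1.le
    positivity
  rw [setIntegral_congr_fun measurableSet_Ioo
    fun t ht => betaKernel_eq_ofReal ht.1 j i, integral_complex_ofReal] at h1
  rw [← h1, Complex.norm_real, Real.norm_of_nonneg (setIntegral_nonneg measurableSet_Ioo h2)]
  refine setIntegral_congr_fun measurableSet_Ioo fun t ht => ?_
  simp only [betaKernel_eq_ofReal ht.1, Complex.norm_real]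
  exact Real.norm_of_nonneg (h2 t ht)

/-! ### Integrating a series term by term -/

theorem integrable_tsum_of_summable_integral_norm {X ι : Type*} [MeasurableSpace X] {ν : Measure X}
    [Countable ι] {F : ι → X → ℂ} (hF : ∀ i, Integrable (F i) ν)
    (hs : Summable fun i => ∫ a, ‖F i a‖ ∂ν) :
    (∀ᵐ a ∂ν, Summable fun i => ‖F i a‖) ∧ Integrable (fun a => ∑' i, F i a) ν := by
  have h1 : ∀ i, eLpNorm (F i) 1 ν = ‖∫ a, ‖F i a‖ ∂ν‖ₑ := fun i => by
    rw [eLpNorm_one_eq_lintegral_enorm, ← ofReal_integral_norm_eq_lintegral_enorm (hF i),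
      Real.enorm_of_nonneg (integral_nonneg fun _ => norm_nonneg _)]
  have h2 : ∑' i, eLpNorm (F i) 1 ν ≠ ⊤ := by
    simp only [h1]
    exact tsum_enorm_ne_top_iff_summable_norm.2 hs.norm
  have h3 := summable_norm_of_tsum_eLpNorm_ne_top le_rfl (fun i => (hF i).1) h2
  refine ⟨h3, ?_, ?_⟩
  · refine aestronglyMeasurable_of_tendsto_ae (u := atTop)
      (f := fun (s : Finset ι) a => ∑ i ∈ s, F i a)
      (fun s => Finset.aestronglyMeasurable_fun_sum s fun i _ => (hF i).1) ?_
    filter_upwards [h3] with a ha using ha.of_norm.hasSum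
  · refine lt_of_le_of_lt (lintegral_mono fun a => enorm_tsum_le_tsum_enorm) ?_
    rw [lintegral_tsum fun i => (hF i).1.enorm]
    simp only [← eLpNorm_one_eq_lintegral_enorm]
    exact h2.lt_top

/-! ### The integral operator on power series -/

/-- The factorials from the two beta integrals cancel the `(i!)²` of the contour expansion, leaving
`betaCoeff`. -/
theorem integral_step (P Q : ℂ) {x y : ℝ} (hx : 0 < x) (hy : 0 < y) {h : ℕ → ℂ} {H : ℂ → ℂ}
    (hh : PSConv h 1) (hH : Set.EqOn H (psum h) (Metric.ball 0 1)) {w : ℂ} (hw : ‖w‖ < 1)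
    {ρ : ℝ → ℝ → ℝ}
    (hρ : ∀ t ∈ Set.Ioo (0 : ℝ) 1, ∀ u ∈ Set.Ioo (0 : ℝ) 1, AdmissibleRadius w t u (ρ t u))
    {K : ℝ → ℝ → ℂ} (hK : ∀ t u, K t u = 1 / (2 * Real.pi * Complex.I) *
      ∮ v in C(0, ρ t u), 1 / v * ((v - 1) / v) ^ (-P) *
        (1 - w * v * (1 - t) * (1 - u)) ^ (-Q) * H (lameW w t u v)) :
    IntegrableOn (fun p : ℝ × ℝ => (p.1 : ℂ) ^ ((x : ℂ) - 1) * ((p.2 : ℂ) ^ ((y : ℂ) - 1) *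
      K p.1 p.2)) (Set.Ioo (0 : ℝ) 1 ×ˢ Set.Ioo (0 : ℝ) 1) ∧
    ∫ t in (0 : ℝ)..1, (t : ℂ) ^ ((x : ℂ) - 1) * ∫ u in (0 : ℝ)..1, (u : ℂ) ^ ((y : ℂ) - 1) * K t u
      = psum (stepCoeff P Q x y h) w := by
  set I : Set ℝ := Set.Ioo 0 1 with hI
  set ν : Measure (ℝ × ℝ) := (volume.restrict I).prod (volume.restrict I) with hν
  have hνeq : ν = volume.restrict (I ×ˢ I) := Measure.prod_restrict I I
  set b : ℝ → ℕ → ℕ → ℝ → ℂ := fun x j i t =>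
    (t : ℂ) ^ ((x : ℂ) - 1) * ((t : ℂ) ^ j * (1 - (t : ℂ)) ^ i) with hb
  set d : ℕ × ℕ → ℂ := fun k => h k.1 * ((ascPochhammer ℂ k.2).eval (P + k.1) / k.2.factorial *
    ((ascPochhammer ℂ k.2).eval (Q + k.1) / k.2.factorial)) * w ^ (k.1 + k.2) with hd
  set F : ℕ × ℕ → ℝ × ℝ → ℂ := fun k p => d k * (b x k.1 k.2 p.1 * b y k.1 k.2 p.2) with hF
  have hfac : ∀ k : ℕ × ℕ, d k * ((k.2.factorial / (ascPochhammer ℂ (k.2 + 1)).eval ((x : ℂ) + k.1))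
      * (k.2.factorial / (ascPochhammer ℂ (k.2 + 1)).eval ((y : ℂ) + k.1)))
      = h k.1 * betaCoeff P Q x y k.1 k.2 * w ^ (k.1 + k.2) := fun k => by
    have h1 : (k.2.factorial : ℂ) ≠ 0 := by exact_mod_cast k.2.factorial_ne_zero
    have h2 := ascPochhammer_eval_ofReal_add_natCast_ne_zero hx k.1 (k.2 + 1)
    have h3 := ascPochhammer_eval_ofReal_add_natCast_ne_zero hy k.1 (k.2 + 1)
    simp only [hd, betaCoeff]
    field_simp
  have hFint : ∀ k, Integrable (F k) ν := fun k =>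
    ((integrableOn_betaKernel hx k.1 k.2).1.mul_prod
      (integrableOn_betaKernel hy k.1 k.2).1).const_mul (d k)
  have hFval : ∀ k, ∫ p, F k p ∂ν = h k.1 * betaCoeff P Q x y k.1 k.2 * w ^ (k.1 + k.2) :=
    fun k => by
      rw [← hfac]
      simp only [hF]
      rw [integral_const_mul, hν, integral_prod_mul, hb, (integrableOn_betaKernel hx k.1 k.2).2,
        (integrableOn_betaKernel hy k.1 k.2).2]
  have hFnorm : ∀ k, ∫ p, ‖F k p‖ ∂ν
      = ‖h k.1‖ * ‖betaCoeff P Q x y k.1 k.2‖ * ‖w‖ ^ (k.1 + k.2) := fun k => by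
    have := congrArg norm (hfac k)
    rw [norm_mul (d k), norm_mul (_ / _)] at this
    rw [← norm_pow, ← norm_mul, ← norm_mul, ← this]
    simp only [hF, norm_mul (d k), norm_mul (b x _ _ _)]
    rw [integral_const_mul, hν, integral_prod_mul (fun t => ‖b x k.1 k.2 t‖)
      (fun t => ‖b y k.1 k.2 t‖), hb, integral_norm_betaKernel hx, integral_norm_betaKernel hy]
  have hsum : Summable fun k => ∫ p, ‖F k p‖ ∂ν := by
    simp only [hFnorm]
    exact summable_norm_betaCoeff P Q hx hy hh (norm_nonneg w) hw
  obtain ⟨hae, hint⟩ := integrable_tsum_of_summable_integral_norm hFint hsum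
  set G : ℝ × ℝ → ℂ := fun p => (p.1 : ℂ) ^ ((x : ℂ) - 1) * ((p.2 : ℂ) ^ ((y : ℂ) - 1) *
    K p.1 p.2) with hG
  -- The radius may depend on `(t, u)` in a non-measurable way. Every admissible radius gives the
  -- same series, so measurability and integrability come from the series.
  have hFG : (fun p => ∑' k, F k p) =ᵐ[ν] G := by
    have hmem : ∀ᵐ p ∂ν, p ∈ I ×ˢ I := by
      rw [hνeq]
      exact ae_restrict_mem (measurableSet_Ioo.prod measurableSet_Ioo)
    filter_upwards [hae, hmem] with p hp hpI
    have hc := (AdmissibleRadius.hasSum_contour (hρ p.1 hpI.1 p.2 hpI.2) hpI.1 hpI.2 P Q hh hH).2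
    rw [← hK] at hc
    simp only [hG]
    rw [hp.of_norm.tsum_prod, ← hc.tsum_eq, ← tsum_mul_left, ← tsum_mul_left]
    refine tsum_congr fun j => ?_
    rw [← tsum_mul_left, ← tsum_mul_left, ← tsum_mul_left]
    refine tsum_congr fun i => ?_
    simp only [hF, hd, hb, pow_add, mul_pow]
    ring
  have hGint : Integrable G ν := hint.congr hFG
  have hGint' : IntegrableOn G (I ×ˢ I) := by rwa [IntegrableOn, ← hνeq]
  refine ⟨hGint', ?_⟩
  have h1 := hasSum_integral_of_summable_integral_norm hFint hsum
  rw [integral_congr_ae hFG] at h1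
  rw [(hasSum_betaCoeff P Q hx hy hh hw).unique ((hasSum_congr hFval).1 h1), hν,
    integral_prod _ hGint, intervalIntegral.integral_of_le zero_le_one,
    integral_Ioc_eq_integral_Ioo]
  refine setIntegral_congr_fun measurableSet_Ioo fun t _ => ?_
  simp only [hG]
  rw [integral_const_mul, intervalIntegral.integral_of_le zero_le_one,
    integral_Ioc_eq_integral_Ioo]

/-! ### Power series of the nested integrals -/

/-- Coefficients of the power series of the `n`-fold nested integral. -/
noncomputable def nestedCoeff (a b c q α : ℂ) (lr : ℝ) : ℕ → ℕ → ℂ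
  | 0 => fun m => (ascPochhammer ℂ m).eval (-α / 4 + lr / 2)
      * (ascPochhammer ℂ m).eval (α / 4 + 1 / 4 + lr / 2)
    / ((ascPochhammer ℂ m).eval (1 + (lr : ℂ) / 2) * (ascPochhammer ℂ m).eval (3 / 4 + (lr : ℂ) / 2))
  | n + 1 => stepCoeff (-(1 / 2 * (α / 2 - (n + 1 : ℕ) - lr)))
      (1 / 2 * (α / 2 + 1 / 2 + (n + 1 : ℕ) + lr))
      (((n + 1 : ℕ) - 1 / 2 + lr) / 2) (((n + 1 : ℕ) + lr) / 2)
      fun N => ((2 * a - b - c) * (N + 1 / 2 * ((n + 1 : ℕ) - 1 + lr)) ^ 2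
        + (-(a / 2 ^ 4) * α * (α + 1) + q / 2 ^ 4)) * nestedCoeff a b c q α lr n N

section

variable {a b c q α : ℂ} {lr : ℝ}

/-- The denominators are written with `m + 1` to fit `tendsto_norm_ratio`, at the price of the
possibly negative offset `lr/2 - 1/4`. -/
theorem nestedCoeff_zero_succ (m : ℕ) : nestedCoeff a b c q α lr 0 (m + 1) =
    (-α / 4 + lr / 2 + m) * (α / 4 + 1 / 4 + lr / 2 + m) /
      ((((lr / 2 : ℝ) : ℂ) + (m + 1 : ℕ)) * (((lr / 2 - 1 / 4 : ℝ) : ℂ) + (m + 1 : ℕ)))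
      * nestedCoeff a b c q α lr 0 m := by
  simp only [nestedCoeff, ascPochhammer_succ_eval]
  rw [div_mul_div_comm]
  push_cast
  congr 1 <;> ring

theorem psConv_nestedCoeff (a b c q α : ℂ) (h0 : 0 ≤ lr) (n : ℕ) :
    PSConv (nestedCoeff a b c q α lr n) 1 := by
  induction n with
  | zero =>
    intro r hr0 hr1
    refine summable_mul_pow_of_le_add_mul (e := fun _ => 0) hr0 hr1 (fun _ => norm_nonneg _)
      (fun _ => le_rfl) (by simp)
      (tendsto_norm_ratio (-α / 4 + lr / 2) (α / 4 + 1 / 4 + lr / 2) (lr / 2) (lr / 2 - 1 / 4))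
      fun m => ?_
    rw [nestedCoeff_zero_succ, norm_mul, zero_add]
  | succ n ih =>
    have h1 := (ih.eqOn_lameDiffOp a b c q α (1 / 2 * ((n + 1 : ℕ) - 1 + lr))
      (fun _ _ => rfl)).1
    refine psConv_stepCoeff _ _ ?_ ?_ h1
    · push_cast
      linarith [(Nat.cast_nonneg n : (0 : ℝ) ≤ n)]
    · positivity

theorem nested_step (h0 : 0 ≤ lr) {ρ : ℕ → ℂ → ℝ → ℝ → ℝ} (hρ : AdmissibleContours ρ) {n : ℕ}
    (hn : Set.EqOn (lameNested a b c q α lr ρ n) (psum (nestedCoeff a b c q α lr n))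
      (Metric.ball 0 1)) {w : ℂ} (hw : ‖w‖ < 1) :
    (∀ t ∈ Set.Ioo (0 : ℝ) 1, ∀ u ∈ Set.Ioo (0 : ℝ) 1,
      CircleIntegrable
        (contourIntegrand a b c q α lr (n + 1) (lameNested a b c q α lr ρ n) w t u)
        0 (ρ (n + 1) w t u)) ∧
    IntegrableOn
      (fun p : ℝ × ℝ => (p.1 : ℂ) ^ (1 / 2 * (((n + 1 : ℕ) : ℂ) - 5 / 2 + lr)) *
        ((p.2 : ℂ) ^ (1 / 2 * (((n + 1 : ℕ) : ℂ) - 2 + lr)) *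
          contourTerm a b c q α lr (n + 1) (lameNested a b c q α lr ρ n) w p.1 p.2
            (ρ (n + 1) w p.1 p.2)))
      (Set.Ioo (0 : ℝ) 1 ×ˢ Set.Ioo (0 : ℝ) 1) ∧
    lameNested a b c q α lr ρ (n + 1) w = psum (nestedCoeff a b c q α lr (n + 1)) w := by
  obtain ⟨h1, h2⟩ := (psConv_nestedCoeff a b c q α h0 n).eqOn_lameDiffOp a b c q α
    (1 / 2 * ((n + 1 : ℕ) - 1 + lr)) hn
  have hn0 : (0 : ℝ) ≤ n := Nat.cast_nonneg n
  have hx : 0 < (((n + 1 : ℕ) : ℝ) - 1 / 2 + lr) / 2 := by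
    push_cast
    linarith
  have hy : 0 < (((n + 1 : ℕ) : ℝ) + lr) / 2 := by positivity
  have ex : (1 / 2 * (((n + 1 : ℕ) : ℂ) - 5 / 2 + lr))
      = (((((n + 1 : ℕ) : ℝ) - 1 / 2 + lr) / 2 : ℝ) : ℂ) - 1 := by
    push_cast
    ring
  have ey : (1 / 2 * (((n + 1 : ℕ) : ℂ) - 2 + lr))
      = (((((n + 1 : ℕ) : ℝ) + lr) / 2 : ℝ) : ℂ) - 1 := by
    push_cast
    ring
  have eP : ∀ v : ℂ, ∀ t u : ℝ,
      contourIntegrand a b c q α lr (n + 1) (lameNested a b c q α lr ρ n) w t u v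
      = 1 / v * ((v - 1) / v) ^ (-(-(1 / 2 * (α / 2 - (n + 1 : ℕ) - lr)))) *
        (1 - w * v * (1 - t) * (1 - u)) ^ (-(1 / 2 * (α / 2 + 1 / 2 + (n + 1 : ℕ) + lr))) *
        lameDiffOp a b c q α (1 / 2 * ((n + 1 : ℕ) - 1 + lr)) (lameNested a b c q α lr ρ n)
          (lameW w t u v) := fun v t u => by
    rw [neg_neg, contourIntegrand]
  obtain ⟨h3, h4⟩ := integral_step (-(1 / 2 * (α / 2 - (n + 1 : ℕ) - lr)))
    (1 / 2 * (α / 2 + 1 / 2 + (n + 1 : ℕ) + lr)) hx hy h1 h2 hw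
    (ρ := ρ (n + 1) w) (hρ (n + 1) w hw)
    (K := fun t u => contourTerm a b c q α lr (n + 1) (lameNested a b c q α lr ρ n) w t u
      (ρ (n + 1) w t u)) (fun t u => by simp only [contourTerm, eP])
  refine ⟨fun t ht u hu => ?_, ?_, ?_⟩
  · have := ((hρ (n + 1) w hw t ht u hu).hasSum_contour ht hu
      (-(1 / 2 * (α / 2 - (n + 1 : ℕ) - lr))) (1 / 2 * (α / 2 + 1 / 2 + (n + 1 : ℕ) + lr)) h1 h2).1
    rwa [← funext fun v => eP v t u] at this
  · rw [ex, ey]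
    exact h3
  · rw [lameNested, lameStep, ex, ey]
    exact h4

theorem eqOn_lameNested (h0 : 0 ≤ lr) {ρ : ℕ → ℂ → ℝ → ℝ → ℝ} (hρ : AdmissibleContours ρ) (n : ℕ) :
    Set.EqOn (lameNested a b c q α lr ρ n) (psum (nestedCoeff a b c q α lr n))
      (Metric.ball 0 1) := by
  induction n with
  | zero => exact fun _ _ => rfl
  | succ n ih => exact fun w hw => (nested_step h0 hρ ih (mem_ball_zero_iff.1 hw)).2.2

/-! ### The innermost series -/

/-- For both exponents the unordered pair `1 + λ/2`, `3/4 + λ/2` is `1`, `3/4 + λ`; the entry `1`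
supplies the factorial. -/
theorem lameSeries_eq_hypergeometric {lam : ℂ} (hlam : lam = 0 ∨ lam = 1 / 2) (w : ℂ) :
    lameSeries α lam w = ₂F₁ (-α / 4 + lam / 2) (α / 4 + 1 / 4 + lam / 2) (3 / 4 + lam) w := by
  rw [ordinaryHypergeometric_eq_tsum, lameSeries]
  refine tsum_congr fun i => ?_
  have h1 : (ascPochhammer ℂ i).eval (1 + lam / 2) * (ascPochhammer ℂ i).eval (3 / 4 + lam / 2)
      = i.factorial * (ascPochhammer ℂ i).eval (3 / 4 + lam) := by
    rcases hlam with rfl | rfl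
    · rw [zero_div, add_zero, add_zero, ascPochhammer_eval_one]
    · norm_num [ascPochhammer_eval_one]
      ring
  rw [h1, smul_eq_mul, div_eq_mul_inv, mul_inv]
  ring

/-! ### Frobenius coefficients with a given number of factors `A` -/

theorem subCoeff_eq_mul (a b c q α lam c₀ : ℂ) : ∀ N n : ℕ,
    subCoeff a b c q α lam c₀ N n = c₀ * subCoeff a b c q α lam 1 N n
  | 0, 0 => by simp [subCoeff]
  | 0, _ + 1 => by simp [subCoeff]
  | 1, 0 => by simp [subCoeff]
  | 1, n + 1 => by
    rw [subCoeff, subCoeff, subCoeff_eq_mul _ _ _ _ _ _ _ 0 n]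
    ring
  | N + 2, 0 => by
    rw [subCoeff, subCoeff, subCoeff_eq_mul _ _ _ _ _ _ _ N 0]
    ring
  | N + 2, n + 1 => by
    rw [subCoeff, subCoeff, subCoeff_eq_mul _ _ _ _ _ _ _ (N + 1) n,
      subCoeff_eq_mul _ _ _ _ _ _ _ N (n + 1)]
    ring

/-- A factor `A` raises the index by 1 and a factor `B` by 2, so `n` factors `A` and `m` factors `B`
lead to index `n + 2m`. -/
theorem subCoeff_eq_zero (a b c q α lam c₀ : ℂ) : ∀ N n : ℕ, (∀ m, N ≠ n + 2 * m) →
    subCoeff a b c q α lam c₀ N n = 0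
  | 0, 0 => fun h => absurd rfl (h 0)
  | 0, _ + 1 => fun _ => by simp [subCoeff]
  | 1, 0 => fun _ => by simp [subCoeff]
  | 1, n + 1 => fun h => by
    rw [subCoeff, subCoeff_eq_zero _ _ _ _ _ _ _ 0 n fun m hm => h m (by omega), mul_zero]
  | N + 2, 0 => fun h => by
    rw [subCoeff, subCoeff_eq_zero _ _ _ _ _ _ _ N 0 fun m hm => h (m + 1) (by omega), mul_zero]
  | N + 2, n + 1 => fun h => by
    rw [subCoeff, subCoeff_eq_zero _ _ _ _ _ _ _ (N + 1) n fun m hm => h m (by omega),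
      subCoeff_eq_zero _ _ _ _ _ _ _ N (n + 1) fun m hm => h (m + 1) (by omega), mul_zero,
      mul_zero, add_zero]

theorem subCoeff_self_succ (a b c q α lam c₀ : ℂ) (n : ℕ) :
    subCoeff a b c q α lam c₀ (n + 1) (n + 1)
      = lameA a b c q α lam n * subCoeff a b c q α lam c₀ n n := by
  cases n with
  | zero => simp [subCoeff]
  | succ n =>
    rw [subCoeff, subCoeff_eq_zero _ _ _ _ _ _ _ n (n + 1 + 1) fun m hm => by omega, mul_zero,
      add_zero]

/-- At index `n + 2m` the numerator is, up to the factor `-4`, the eigenvalue of the level `n + 1`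
differential operator on the `m`-th monomial, and the denominators are twice the beta parameters
shifted by `m`. -/
theorem lameA_eq (hab : a ≠ b) (hac : a ≠ c) (h0 : 0 ≤ lr) (n m : ℕ) :
    lameA a b c q α lr (n + 2 * m) = -1 / ((a - b) * (a - c)) *
      (((2 * a - b - c) * (m + 1 / 2 * ((n + 1 : ℕ) - 1 + lr)) ^ 2
        + (-(a / 2 ^ 4) * α * (α + 1) + q / 2 ^ 4)) /
      (((((n + 1 : ℕ) - 1 / 2 + lr) / 2 : ℝ) + m) * ((((n + 1 : ℕ) + lr) / 2 : ℝ) + m))) := by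
  have h1 : a - b ≠ 0 := sub_ne_zero.2 hab
  have h2 : a - c ≠ 0 := sub_ne_zero.2 hac
  have h3 := ofReal_add_natCast_ne_zero (x := ((n + 1 : ℕ) - 1 / 2 + lr) / 2)
    (by push_cast; linarith [(Nat.cast_nonneg n : (0 : ℝ) ≤ n)]) m
  have h4 := ofReal_add_natCast_ne_zero (x := ((n + 1 : ℕ) + lr) / 2) (by positivity) m
  have e3 : ((n + 2 * m : ℕ) + 1 / 2 + lr : ℂ)
      = 2 * ((((n + 1 : ℕ) - 1 / 2 + lr) / 2 : ℝ) + m) := by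
    push_cast
    ring
  have e4 : ((n + 2 * m : ℕ) + 1 + lr : ℂ) = 2 * ((((n + 1 : ℕ) + lr) / 2 : ℝ) + m) := by
    push_cast
    ring
  rw [lameA, e3, e4]
  generalize ((((n + 1 : ℕ) - 1 / 2 + lr) / 2 : ℝ) + m : ℂ) = X at *
  generalize ((((n + 1 : ℕ) + lr) / 2 : ℝ) + m : ℂ) = Y at *
  field_simp
  push_cast
  ring

theorem lameB_eq (hab : a ≠ b) (hac : a ≠ c) (h0 : 0 ≤ lr) (n m : ℕ) :
    lameB a b c α lr (n + 2 * (m + 1)) = -1 / ((a - b) * (a - c)) *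
      ((-(1 / 2 * (α / 2 - (n + 1 : ℕ) - lr)) + m) *
        (1 / 2 * (α / 2 + 1 / 2 + (n + 1 : ℕ) + lr) + m) /
      (((((n + 1 : ℕ) - 1 / 2 + lr) / 2 : ℝ) + (m + 1 : ℕ)) *
        ((((n + 1 : ℕ) + lr) / 2 : ℝ) + (m + 1 : ℕ)))) := by
  have h1 : a - b ≠ 0 := sub_ne_zero.2 hab
  have h2 : a - c ≠ 0 := sub_ne_zero.2 hac
  have h3 := ofReal_add_natCast_ne_zero (x := ((n + 1 : ℕ) - 1 / 2 + lr) / 2)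
    (by push_cast; linarith [(Nat.cast_nonneg n : (0 : ℝ) ≤ n)]) (m + 1)
  have h4 := ofReal_add_natCast_ne_zero (x := ((n + 1 : ℕ) + lr) / 2) (by positivity) (m + 1)
  have e3 : ((n + 2 * (m + 1) : ℕ) + 1 / 2 + lr : ℂ)
      = 2 * ((((n + 1 : ℕ) - 1 / 2 + lr) / 2 : ℝ) + (m + 1 : ℕ)) := by
    push_cast
    ring
  have e4 : ((n + 2 * (m + 1) : ℕ) + 1 + lr : ℂ)
      = 2 * ((((n + 1 : ℕ) + lr) / 2 : ℝ) + (m + 1 : ℕ)) := by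
    push_cast
    ring
  rw [lameB, e3, e4]
  generalize ((((n + 1 : ℕ) - 1 / 2 + lr) / 2 : ℝ) + (m + 1 : ℕ) : ℂ) = X at *
  generalize ((((n + 1 : ℕ) + lr) / 2 : ℝ) + (m + 1 : ℕ) : ℂ) = Y at *
  field_simp
  push_cast
  ring

theorem lameB_odd (hab : a ≠ b) (hac : a ≠ c) (h0 : 0 ≤ lr) (m : ℕ) :
    lameB a b c α lr (2 * m + 1) = -1 / ((a - b) * (a - c)) *
      ((-α / 4 + lr / 2 + m) * (α / 4 + 1 / 4 + lr / 2 + m) /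
      ((((lr / 2 : ℝ) : ℂ) + (m + 1 : ℕ)) * (((lr / 2 - 1 / 4 : ℝ) : ℂ) + (m + 1 : ℕ)))) := by
  have h1 : a - b ≠ 0 := sub_ne_zero.2 hab
  have h2 : a - c ≠ 0 := sub_ne_zero.2 hac
  have h3 : (((lr / 2 - 1 / 4 : ℝ) : ℂ) + (m + 1 : ℕ)) ≠ 0 := by
    have := ofReal_add_natCast_ne_zero (x := lr / 2 + 3 / 4) (by positivity) m
    intro h
    apply this
    rw [← h]
    push_cast
    ring
  have h4 : (((lr / 2 : ℝ) : ℂ) + (m + 1 : ℕ)) ≠ 0 := by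
    have := ofReal_add_natCast_ne_zero (x := lr / 2 + 1) (by positivity) m
    intro h
    apply this
    rw [← h]
    push_cast
    ring
  have e3 : ((2 * m + 1 : ℕ) + 1 / 2 + lr : ℂ)
      = 2 * (((lr / 2 - 1 / 4 : ℝ) : ℂ) + (m + 1 : ℕ)) := by
    push_cast
    ring
  have e4 : ((2 * m + 1 : ℕ) + 1 + lr : ℂ) = 2 * (((lr / 2 : ℝ) : ℂ) + (m + 1 : ℕ)) := by
    push_cast
    ring
  rw [lameB, e3, e4]
  generalize (((lr / 2 - 1 / 4 : ℝ) : ℂ) + (m + 1 : ℕ)) = X at *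
  generalize (((lr / 2 : ℝ) : ℂ) + (m + 1 : ℕ)) = Y at *
  field_simp
  push_cast
  ring

/-- Both sides satisfy the same recurrence in `m`, with level `n` as the source for level `n + 1`.
Each of the `n` factors `A` and `m` factors `B` contributes one `-1/D`. -/
theorem subCoeff_eq_nestedCoeff (hab : a ≠ b) (hac : a ≠ c) (h0 : 0 ≤ lr) (n m : ℕ) :
    subCoeff a b c q α lr 1 (n + 2 * m) n
      = nestedCoeff a b c q α lr n m * (-1 / ((a - b) * (a - c))) ^ (n + m) := by
  induction n generalizing m with
  | zero =>
    induction m with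
    | zero => simp [subCoeff, nestedCoeff]
    | succ m ih =>
      rw [show 0 + 2 * (m + 1) = (0 + 2 * m) + 2 by ring, subCoeff, ih, nestedCoeff_zero_succ,
        show 0 + 2 * m + 1 = 2 * m + 1 by ring, lameB_odd hab hac h0]
      ring
  | succ n ihn =>
    induction m with
    | zero =>
      have h1 := lameA_eq (q := q) (α := α) hab hac h0 n 0
      have h2 := ihn 0
      simp only [mul_zero, add_zero] at h1 h2 ⊢
      rw [subCoeff_self_succ, h1, h2, nestedCoeff, stepCoeff_zero]
      simp only [Nat.cast_zero, add_zero]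
      ring
    | succ m ih =>
      have h1 := lameA_eq (q := q) (α := α) hab hac h0 n (m + 1)
      rw [show n + 1 + 2 * (m + 1) = (n + 1 + 2 * m) + 2 by ring, subCoeff, ih,
        show n + 1 + 2 * m + 1 = n + 2 * (m + 1) by ring, ihn, h1, lameB_eq hab hac h0,
        show nestedCoeff a b c q α lr (n + 1) (m + 1) = stepCoeff _ _ _ _ _ (m + 1) from rfl,
        stepCoeff_succ, ← nestedCoeff]
      ring

/-- Only indices `n + 2m` occur, so this is a series in `z²/D`, and the unit disc in `η` becomes
`|z| < √|D|`. -/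
theorem psConv_subCoeff (q α : ℂ) (hab : a ≠ b) (hac : a ≠ c) (h0 : 0 ≤ lr) (n : ℕ) :
    PSConv (fun N => subCoeff a b c q α lr 1 N n) (Real.sqrt ‖(a - b) * (a - c)‖) := by
  intro r hr0 hr
  have hD : 0 < ‖(a - b) * (a - c)‖ :=
    norm_pos_iff.2 (mul_ne_zero (sub_ne_zero.2 hab) (sub_ne_zero.2 hac))
  have hr2 : r ^ 2 / ‖(a - b) * (a - c)‖ < 1 := (div_lt_one hD).2 ((Real.lt_sqrt hr0).1 hr)
  have hinj : Function.Injective fun m : ℕ => n + 2 * m := fun i j h => by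
    simp only at h
    omega
  rw [← hinj.summable_iff fun N hN => by
    beta_reduce
    rw [subCoeff_eq_zero _ _ _ _ _ _ _ N n fun m hm => hN ⟨m, hm.symm⟩, norm_zero, zero_mul]]
  have h1 := (psConv_nestedCoeff a b c q α h0 n _ (by positivity) hr2).mul_left
    (r ^ n / ‖(a - b) * (a - c)‖ ^ n)
  refine h1.congr fun m => ?_
  simp only [Function.comp]
  rw [subCoeff_eq_nestedCoeff hab hac h0, norm_mul (nestedCoeff _ _ _ _ _ _ _ _), norm_pow, norm_div, norm_neg, norm_one,
    one_div]
  ring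

theorem norm_lameEta_lt_one (hab : a ≠ b) (hac : a ≠ c) {z : ℂ}
    (hz : ‖z‖ ^ 2 < ‖(a - b) * (a - c)‖) : ‖lameEta a b c z‖ < 1 := by
  have hD : 0 < ‖(a - b) * (a - c)‖ :=
    norm_pos_iff.2 (mul_ne_zero (sub_ne_zero.2 hab) (sub_ne_zero.2 hac))
  rw [lameEta, norm_div, norm_neg, norm_pow]
  exact (div_lt_one hD).2 hz

theorem psum_subCoeff (hab : a ≠ b) (hac : a ≠ c) (h0 : 0 ≤ lr) (n : ℕ) {z : ℂ}
    (hz : ‖z‖ ^ 2 < ‖(a - b) * (a - c)‖) :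
    psum (fun N => subCoeff a b c q α lr 1 N n) z
      = psum (nestedCoeff a b c q α lr n) (lameEta a b c z) * lameMu a b c z ^ n := by
  have h1 := ((psConv_nestedCoeff a b c q α h0 n).hasSum
    (norm_lameEta_lt_one hab hac hz)).mul_right (lameMu a b c z ^ n)
  have hinj : Function.Injective fun m : ℕ => n + 2 * m := fun i j h => by
    simp only at h
    omega
  refine HasSum.tsum_eq ?_
  rw [← hinj.hasSum_iff fun N hN => by
    beta_reduce
    rw [subCoeff_eq_zero _ _ _ _ _ _ _ N n fun m hm => hN ⟨m, hm.symm⟩, zero_mul]]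
  refine (hasSum_congr fun m => ?_).1 h1
  simp only [Function.comp]
  rw [subCoeff_eq_nestedCoeff hab hac h0, lameEta, lameMu]
  generalize (a - b) * (a - c) = D
  rw [show -z ^ 2 / D = -1 / D * z ^ 2 by ring, show -z / D = -1 / D * z by ring]
  ring

end

/-! ### The differential equation for power series -/

/-- With `θ = z d/dz + λ`, the operator on `c` is `D θ(θ - 1/2) + z² (θ - α/2)(θ + (α+1)/2)`. The
hypotheses are the coefficients of `z⁰` (indicial equation), `z¹` and `z^(N+2)`. Keeping `d`
separate lets it be the preceding level. -/
theorem psum_ode {c d : ℕ → ℂ} {R : ℝ} (hc : PSConv c R) (hd : PSConv d R) {D s k α lam : ℂ}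
    (h0 : D * (lam * (lam - 1 / 2)) * c 0 = 0)
    (h1 : D * ((1 + lam) * (1 / 2 + lam)) * c 1 + (s * lam ^ 2 + k) * d 0 = 0)
    (h2 : ∀ N : ℕ, D * ((N + 2 + lam) * (N + 3 / 2 + lam)) * c (N + 2)
      + (s * (N + 1 + lam) ^ 2 + k) * d (N + 1)
      + (N + lam - α / 2) * (N + lam + (α + 1) / 2) * c N = 0) {z : ℂ} (hz : ‖z‖ < R) :
    (D + z ^ 2) * psum (fun N => ((N : ℂ) + lam) * (((N : ℂ) + lam) * c N)) z
      + 1 / 2 * (z ^ 2 - D) * psum (fun N => ((N : ℂ) + lam) * c N) z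
      - z ^ 2 * (α * (α + 1) / 4) * psum c z
      + z * (s * psum (fun N => ((N : ℂ) + lam) * (((N : ℂ) + lam) * d N)) z + k * psum d z) = 0 := by
  have c0 := hc.hasSum hz
  have c1 := (hc.add_mul lam).hasSum hz
  have c2 := ((hc.add_mul lam).add_mul lam).hasSum hz
  have d0 := hd.hasSum hz
  have d2 := ((hd.add_mul lam).add_mul lam).hasSum hz
  -- Two terms are removed here and one in the `d` series, so that all three series are aligned at
  -- `z^(N+2)`.
  have hA := (hasSum_nat_add_iff' 2).2 ((c2.mul_left D).sub (c1.mul_left (D / 2)))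
  have hB := ((hasSum_nat_add_iff' 1).2 ((d2.mul_left s).add (d0.mul_left k))).mul_left z
  have hC := ((c2.add (c1.mul_left (1 / 2))).sub (c0.mul_left (α * (α + 1) / 4))).mul_left (z ^ 2)
  have h3 := ((hA.add hB).add hC).unique ((hasSum_congr (g := fun _ => (0 : ℂ)) fun N => ?_).2
    hasSum_zero)
  · simp only [Finset.sum_range_succ, Finset.sum_range_zero, Nat.cast_zero, Nat.cast_one, pow_zero,
      pow_one, zero_add, mul_one] at h3
    linear_combination h3 + h0 + z * h1
  · push_cast
    linear_combination z ^ (N + 2) * h2 N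

/-! ### Growth along rays -/

/-- Solving the equation for `t₂` at level `n + 1` brings in `t₂` at level `n` with weighted
coefficient `ε |s z|`. This is smaller than `|D + z²|` by at least `m`, so a bound independent of
the level propagates by induction. -/
theorem weighted_second_bound {D s k κ z : ℂ} {p t₁ t₂ : ℕ → ℂ} {ε m B : ℝ} {N : ℕ} (hε : 0 < ε)
    (hm : 0 < m) (hB : 0 ≤ B) (hz : ‖z‖ ^ 2 ≤ ‖D‖) (hmz : m ≤ ‖D + z ^ 2‖ - ε * ‖s * z‖)
    (hode0 : (D + z ^ 2) * t₂ 0 + 1 / 2 * (z ^ 2 - D) * t₁ 0 - z ^ 2 * κ * p 0 = 0)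
    (hode : ∀ n, (D + z ^ 2) * t₂ (n + 1) + 1 / 2 * (z ^ 2 - D) * t₁ (n + 1)
      - z ^ 2 * κ * p (n + 1) + z * (s * t₂ n + k * p n) = 0)
    (hp : ∀ n ≤ N, ε ^ n * ‖p n‖ ≤ B) (ht : ∀ n ≤ N, ε ^ n * ‖t₁ n‖ ≤ B) :
    ∀ n ≤ N, ε ^ n * ‖t₂ n‖
      ≤ (‖D‖ + ‖D‖ * ‖κ‖ + Real.sqrt ‖D‖ * (ε * ‖k‖)) / m * B := by
  set C := ‖D‖ + ‖D‖ * ‖κ‖ + Real.sqrt ‖D‖ * (ε * ‖k‖) with hC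
  have hz1 : ‖z‖ ≤ Real.sqrt ‖D‖ := Real.le_sqrt_of_sq_le hz
  have hDz : 0 < ‖D + z ^ 2‖ := by
    have : 0 ≤ ε * ‖s * z‖ := by positivity
    linarith
  have hhalf : ‖(1 / 2 : ℂ) * (z ^ 2 - D)‖ ≤ ‖D‖ := by
    rw [norm_mul]
    have h1 : ‖(1 / 2 : ℂ)‖ = 1 / 2 := by norm_num
    have h2 : ‖z ^ 2 - D‖ ≤ ‖D‖ + ‖D‖ :=
      (norm_sub_le _ _).trans (by rw [norm_pow]; linarith)
    rw [h1]
    linarith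
  have hκz : ‖z ^ 2 * κ‖ ≤ ‖D‖ * ‖κ‖ := by
    rw [norm_mul, norm_pow]
    gcongr
  have two : ∀ n ≤ N, ε ^ n * ‖1 / 2 * (z ^ 2 - D) * t₁ n - z ^ 2 * κ * p n‖
      ≤ (‖D‖ + ‖D‖ * ‖κ‖) * B := fun n hn => by
    calc ε ^ n * ‖1 / 2 * (z ^ 2 - D) * t₁ n - z ^ 2 * κ * p n‖
        ≤ ε ^ n * (‖1 / 2 * (z ^ 2 - D)‖ * ‖t₁ n‖ + ‖z ^ 2 * κ‖ * ‖p n‖) := by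
          rw [← norm_mul, ← norm_mul]
          gcongr
          exact norm_sub_le _ _
      _ = ‖1 / 2 * (z ^ 2 - D)‖ * (ε ^ n * ‖t₁ n‖) + ‖z ^ 2 * κ‖ * (ε ^ n * ‖p n‖) := by ring
      _ ≤ ‖D‖ * B + ‖D‖ * ‖κ‖ * B := by
          gcongr
          · exact ht n hn
          · exact hp n hn
      _ = _ := by ring
  have hCB : C / m * B * m = C * B := by field_simp
  have hCB0 : 0 ≤ C / m * B := by positivity
  intro n
  induction n with
  | zero =>
    intro hn
    have h1 := two 0 hn
    have h2 : ‖D + z ^ 2‖ * ‖t₂ 0‖ = ‖1 / 2 * (z ^ 2 - D) * t₁ 0 - z ^ 2 * κ * p 0‖ := by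
      rw [← norm_mul, ← norm_neg]
      congr 1
      linear_combination -hode0
    rw [pow_zero, one_mul] at h1 ⊢
    rw [← h2] at h1
    have h3 : 0 ≤ Real.sqrt ‖D‖ * (ε * ‖k‖) * B := by positivity
    have h4 : ‖D + z ^ 2‖ * ‖t₂ 0‖ ≤ C / m * B * ‖D + z ^ 2‖ := by
      have : C / m * B * m ≤ C / m * B * ‖D + z ^ 2‖ := by
        gcongr
        have : 0 ≤ ε * ‖s * z‖ := by positivity
        linarith
      rw [hCB] at this
      refine le_trans ?_ this
      rw [hC]
      linarith
    exact le_of_mul_le_mul_left (by linarith) hDz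
  | succ n ih =>
    intro hn
    have h1 := two (n + 1) hn
    have h2 := ih (by omega)
    have h3 := hp n (by omega)
    have h4 : ‖D + z ^ 2‖ * ‖t₂ (n + 1)‖ ≤
        ‖1 / 2 * (z ^ 2 - D) * t₁ (n + 1) - z ^ 2 * κ * p (n + 1)‖
          + (‖s * z‖ * ‖t₂ n‖ + ‖z‖ * ‖k‖ * ‖p n‖) := by
      rw [← norm_mul, ← norm_mul, ← norm_mul, ← norm_mul]
      have e : (D + z ^ 2) * t₂ (n + 1) = -((1 / 2 * (z ^ 2 - D) * t₁ (n + 1)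
          - z ^ 2 * κ * p (n + 1)) + (s * z * t₂ n + z * k * p n)) := by
        linear_combination hode n
      rw [e, norm_neg]
      exact (norm_add_le _ _).trans (by gcongr; exact norm_add_le _ _)
    have h5 : ‖D + z ^ 2‖ * (ε ^ (n + 1) * ‖t₂ (n + 1)‖) ≤ ‖D + z ^ 2‖ * (C / m * B) := by
      calc ‖D + z ^ 2‖ * (ε ^ (n + 1) * ‖t₂ (n + 1)‖)
          = ε ^ (n + 1) * (‖D + z ^ 2‖ * ‖t₂ (n + 1)‖) := by ring
        _ ≤ ε ^ (n + 1) * (‖1 / 2 * (z ^ 2 - D) * t₁ (n + 1) - z ^ 2 * κ * p (n + 1)‖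
          + (‖s * z‖ * ‖t₂ n‖ + ‖z‖ * ‖k‖ * ‖p n‖)) := by gcongr
        _ = ε ^ (n + 1) * ‖1 / 2 * (z ^ 2 - D) * t₁ (n + 1) - z ^ 2 * κ * p (n + 1)‖
          + (ε * ‖s * z‖ * (ε ^ n * ‖t₂ n‖) + ‖z‖ * (ε * ‖k‖) * (ε ^ n * ‖p n‖)) := by ring
        _ ≤ (‖D‖ + ‖D‖ * ‖κ‖) * B + (ε * ‖s * z‖ * (C / m * B)
          + Real.sqrt ‖D‖ * (ε * ‖k‖) * B) := by gcongr
        _ = C / m * B * m + ε * ‖s * z‖ * (C / m * B) := by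
          rw [hCB, hC]
          ring
        _ ≤ C / m * B * (‖D + z ^ 2‖ - ε * ‖s * z‖) + ε * ‖s * z‖ * (C / m * B) := by gcongr
        _ = _ := by ring
    exact le_of_mul_le_mul_left h5 hDz

/-- Growth of solutions of the perturbed equations along a ray, uniformly in the order. -/
theorem weighted_ray_bound {D s k κ lam z : ℂ} {p t₁ t₂ : ℕ → ℂ → ℂ} {ε m τ₀ M : ℝ} (hε : 0 < ε)
    (hm : 0 < m) (hτ₀ : 0 < τ₀) (hτ₁ : τ₀ ≤ 1) (hz : ‖z‖ ^ 2 < ‖D‖)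
    (hmz : ∀ τ : ℝ, τ₀ ≤ τ → τ ≤ 1 → m ≤ ‖D + (τ * z) ^ 2‖ - ε * ‖s * (τ * z)‖)
    (hode0 : ∀ z : ℂ, ‖z‖ ^ 2 < ‖D‖ →
      (D + z ^ 2) * t₂ 0 z + 1 / 2 * (z ^ 2 - D) * t₁ 0 z - z ^ 2 * κ * p 0 z = 0)
    (hode : ∀ n, ∀ z : ℂ, ‖z‖ ^ 2 < ‖D‖ →
      (D + z ^ 2) * t₂ (n + 1) z + 1 / 2 * (z ^ 2 - D) * t₁ (n + 1) z
      - z ^ 2 * κ * p (n + 1) z + z * (s * t₂ n z + k * p n z) = 0)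
    (hp' : ∀ n, ∀ z : ℂ, ‖z‖ ^ 2 < ‖D‖ → DifferentiableAt ℂ (p n) z ∧
      z * deriv (p n) z + lam * p n z = t₁ n z)
    (ht' : ∀ n, ∀ z : ℂ, ‖z‖ ^ 2 < ‖D‖ → DifferentiableAt ℂ (t₁ n) z ∧
      z * deriv (t₁ n) z + lam * t₁ n z = t₂ n z)
    (hM : 0 ≤ M) (hpM : ∀ n, ε ^ n * ‖p n (τ₀ * z)‖ ≤ M)
    (htM : ∀ n, ε ^ n * ‖t₁ n (τ₀ * z)‖ ≤ M) (n : ℕ) :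
    let C := (‖D‖ + ‖D‖ * ‖κ‖ + Real.sqrt ‖D‖ * (ε * ‖k‖)) / m
    let B := M * Real.exp ((1 + C + ‖lam‖) / τ₀)
    ε ^ n * ‖p n z‖ ≤ B ∧ ε ^ n * ‖t₁ n z‖ ≤ B ∧ ε ^ n * ‖t₂ n z‖ ≤ C * B := by
  intro C B
  have hC0 : 0 ≤ C := by positivity
  have hnorm : ∀ τ ∈ Set.Icc τ₀ 1, ‖(τ : ℂ) * z‖ ^ 2 < ‖D‖ := fun τ hτ => by
    rw [norm_mul, Complex.norm_real, Real.norm_of_nonneg (hτ₀.le.trans hτ.1)]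
    have h0 : 0 ≤ τ := hτ₀.le.trans hτ.1
    exact lt_of_le_of_lt (pow_le_pow_left₀ (by positivity)
      (mul_le_of_le_one_left (norm_nonneg z) hτ.2) 2) hz
  -- All levels up to `n` form one vector with the sup norm, so the Gronwall constant does not
  -- depend on `n`.
  set F : ℝ → Fin (n + 1) → ℂ × ℂ := fun τ j =>
    ((ε : ℂ) ^ (j : ℕ) * p j (τ * z), (ε : ℂ) ^ (j : ℕ) * t₁ j (τ * z)) with hF
  set F' : ℝ → Fin (n + 1) → ℂ × ℂ := fun τ j =>
    ((ε : ℂ) ^ (j : ℕ) * (deriv (p j) (τ * z) * z),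
      (ε : ℂ) ^ (j : ℕ) * (deriv (t₁ j) (τ * z) * z)) with hF'
  have hline : ∀ τ : ℝ, HasDerivAt (fun τ : ℝ => (τ : ℂ) * z) z τ := fun τ => by
    simpa using (Complex.ofRealCLM.hasDerivAt (x := τ)).mul_const z
  have hderiv : ∀ τ ∈ Set.Icc τ₀ 1, HasDerivAt F (F' τ) τ := fun τ hτ => by
    refine hasDerivAt_pi.2 fun j => HasDerivAt.prodMk ?_ ?_
    · exact ((hp' j _ (hnorm τ hτ)).1.hasDerivAt.comp τ (hline τ)).const_mul _
    · exact ((ht' j _ (hnorm τ hτ)).1.hasDerivAt.comp τ (hline τ)).const_mul _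
  have hεn : ∀ j : ℕ, ‖(ε : ℂ) ^ j‖ = ε ^ j := fun j => by
    rw [norm_pow, Complex.norm_real, Real.norm_of_nonneg hε.le]
  have hpF : ∀ τ : ℝ, ∀ j ≤ n, ε ^ j * ‖p j (τ * z)‖ ≤ ‖F τ‖ := fun τ j hj => by
    rw [← hεn, ← norm_mul]
    exact (norm_fst_le (F τ ⟨j, by omega⟩)).trans (norm_le_pi_norm (F τ) ⟨j, by omega⟩)
  have htF : ∀ τ : ℝ, ∀ j ≤ n, ε ^ j * ‖t₁ j (τ * z)‖ ≤ ‖F τ‖ := fun τ j hj => by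
    rw [← hεn, ← norm_mul]
    exact (norm_snd_le (F τ ⟨j, by omega⟩)).trans (norm_le_pi_norm (F τ) ⟨j, by omega⟩)
  have hXF : ∀ τ ∈ Set.Icc τ₀ 1, ∀ j ≤ n, ε ^ j * ‖t₂ j (τ * z)‖ ≤ C * ‖F τ‖ := fun τ hτ =>
    weighted_second_bound (p := fun j => p j (τ * z)) (t₁ := fun j => t₁ j (τ * z))
      (t₂ := fun j => t₂ j (τ * z)) hε hm (norm_nonneg _) (hnorm τ hτ).le (hmz τ hτ.1 hτ.2)
      (hode0 _ (hnorm τ hτ)) (fun j => hode j _ (hnorm τ hτ)) (hpF τ) (htF τ)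
  -- Converting the Euler derivative into `d/dτ` costs a factor `1/τ`; starting at `τ₀ > 0` keeps it
  -- bounded.
  have hbound : ∀ τ ∈ Set.Ico τ₀ 1, ‖F' τ‖ ≤ (1 + C + ‖lam‖) / τ₀ * ‖F τ‖ + 0 := by
    intro τ hτ
    have hτ' : τ ∈ Set.Icc τ₀ 1 := ⟨hτ.1, hτ.2.le⟩
    have hτpos : 0 < τ := hτ₀.trans_le hτ.1
    have hτC : (τ : ℂ) ≠ 0 := by exact_mod_cast hτpos.ne'
    have key : ∀ (j : ℕ) (f g : ℂ → ℂ), j ≤ n →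
        (τ * z) * deriv f (τ * z) + lam * f (τ * z) = g (τ * z) →
        ε ^ j * ‖f (τ * z)‖ ≤ ‖F τ‖ → ε ^ j * ‖g (τ * z)‖ ≤ (1 + C) * ‖F τ‖ →
        ‖(ε : ℂ) ^ j * (deriv f (τ * z) * z)‖ ≤ (1 + C + ‖lam‖) / τ₀ * ‖F τ‖ + 0 := by
      intro j f g hj h1 h2 h3
      have e : deriv f (τ * z) * z = (g (τ * z) - lam * f (τ * z)) / τ := by
        rw [eq_div_iff hτC, ← h1]
        ring
      rw [norm_mul, hεn, e, norm_div, Complex.norm_real, Real.norm_of_nonneg hτpos.le, add_zero]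
      calc ε ^ j * (‖g (τ * z) - lam * f (τ * z)‖ / τ)
          ≤ ε ^ j * ((‖g (τ * z)‖ + ‖lam‖ * ‖f (τ * z)‖) / τ₀) := by
            rw [← norm_mul]
            gcongr
            · exact norm_sub_le _ _
            · exact hτ.1
        _ = (ε ^ j * ‖g (τ * z)‖ + ‖lam‖ * (ε ^ j * ‖f (τ * z)‖)) / τ₀ := by ring
        _ ≤ ((1 + C) * ‖F τ‖ + ‖lam‖ * ‖F τ‖) / τ₀ := by gcongr
        _ = _ := by ring
    have h0 : 0 ≤ (1 + C + ‖lam‖) / τ₀ * ‖F τ‖ + 0 := by positivity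
    rw [pi_norm_le_iff_of_nonneg h0]
    intro j
    have hj : (j : ℕ) ≤ n := by omega
    have hCF : 0 ≤ C * ‖F τ‖ := by positivity
    have hF0 : 0 ≤ ‖F τ‖ := norm_nonneg _
    rw [Prod.norm_def]
    refine max_le (key j (p j) (t₁ j) hj (hp' j _ (hnorm τ hτ')).2 (hpF τ j hj) ?_)
      (key j (t₁ j) (t₂ j) hj (ht' j _ (hnorm τ hτ')).2 (htF τ j hj) ?_)
    · linarith [htF τ j hj]
    · linarith [hXF τ hτ' j hj]
  have hFM : ‖F τ₀‖ ≤ M := by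
    rw [pi_norm_le_iff_of_nonneg hM]
    intro j
    rw [Prod.norm_def, hF]
    simp only [norm_mul, hεn]
    exact max_le (hpM j) (htM j)
  have hgr := norm_le_gronwallBound_of_norm_deriv_right_le (f := F) (f' := F')
    (fun τ hτ => (hderiv τ hτ).continuousAt.continuousWithinAt)
    (fun τ hτ => (hderiv τ ⟨hτ.1, hτ.2.le⟩).hasDerivWithinAt) hFM hbound 1 ⟨hτ₁, le_rfl⟩
  rw [gronwallBound_ε0] at hgr
  have hFB : ‖F 1‖ ≤ B := by
    exact hgr.trans (mul_le_mul_of_nonneg_left (Real.exp_le_exp.2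
      (mul_le_of_le_one_right (by positivity) (by linarith))) hM)
  have h1 := hpF 1 n le_rfl
  have h2 := htF 1 n le_rfl
  have h3 := hXF 1 ⟨hτ₁, le_rfl⟩ n le_rfl
  rw [Complex.ofReal_one, one_mul] at h1 h2 h3
  exact ⟨h1.trans hFB, h2.trans hFB, h3.trans (by gcongr)⟩

section

variable {a b c q α : ℂ} {lr : ℝ}

/-! ### The recurrence coefficients -/

theorem tendsto_lameA (a b c q α lam : ℂ) :
    Tendsto (lameA a b c q α lam) atTop (𝓝 (-(2 * a - b - c) / ((a - b) * (a - c)))) := by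
  have h1 := tendsto_add_mul_div_add_mul_atTop_nhds lam (1 + lam) 1 one_ne_zero
  have h2 := tendsto_add_mul_div_add_mul_atTop_nhds lam (1 / 2 + lam) 1 one_ne_zero
  have h3 := tendsto_add_mul_div_add_mul_atTop_nhds (1 : ℂ) (1 + lam) 0 one_ne_zero
  have h4 := tendsto_add_mul_div_add_mul_atTop_nhds (1 : ℂ) (1 / 2 + lam) 0 one_ne_zero
  have h5 := (((h3.mul h4).const_mul (1 / 4 * (α * (α + 1) * a - q))).sub
    ((h1.mul h2).const_mul (2 * a - b - c))).mul_const ((a - b) * (a - c))⁻¹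
  refine (h5.congr fun n => ?_).trans (le_of_eq ?_)
  · simp only [lameA, div_eq_mul_inv, mul_inv]
    ring
  · congr 1
    simp [div_eq_mul_inv]

theorem tendsto_lameB (a b c α lam : ℂ) :
    Tendsto (lameB a b c α lam) atTop (𝓝 (-1 / ((a - b) * (a - c)))) := by
  have h1 := tendsto_add_mul_div_add_mul_atTop_nhds ((α - 1) / 2 + lam) (1 + lam) 1 one_ne_zero
  have h2 := tendsto_add_mul_div_add_mul_atTop_nhds ((α + 2) / 2 - lam) (1 / 2 + lam) (-1)
    one_ne_zero
  have h3 := (h1.mul h2).mul_const ((a - b) * (a - c))⁻¹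
  refine (h3.congr fun n => ?_).trans (le_of_eq ?_)
  · simp only [lameB, div_eq_mul_inv, mul_inv]
    ring
  · congr 1
    simp [div_eq_mul_inv]

/-- The coefficients converge, hence are bounded by some `A` and `B`, and each factor `A` absorbs
one weight `ε`. The value `Q = ε A + B + 1` satisfies `ε A Q + B ≤ Q²`, which closes the two-step
induction. -/
theorem exists_pow_bound_subCoeff (a b c q α lam : ℂ) {ε : ℝ} (hε : 0 ≤ ε) :
    ∃ Q : ℝ, 1 ≤ Q ∧ ∀ N n, ε ^ n * ‖subCoeff a b c q α lam 1 N n‖ ≤ Q ^ N := by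
  obtain ⟨A, hA⟩ := (tendsto_lameA a b c q α lam).norm.bddAbove_range
  obtain ⟨B, hB⟩ := (tendsto_lameB a b c α lam).norm.bddAbove_range
  have hA' : ∀ n, ‖lameA a b c q α lam n‖ ≤ A := fun n => hA ⟨n, rfl⟩
  have hB' : ∀ n, ‖lameB a b c α lam n‖ ≤ B := fun n => hB ⟨n, rfl⟩
  have hA0 : 0 ≤ A := (norm_nonneg _).trans (hA' 0)
  have hB0 : 0 ≤ B := (norm_nonneg _).trans (hB' 0)
  set Q := ε * A + B + 1 with hQ
  have hQ1 : 1 ≤ Q := by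
    have : 0 ≤ ε * A := by positivity
    linarith
  have hstep : ε * A * Q + B ≤ Q ^ 2 := by
    have : 0 ≤ ε * A := by positivity
    nlinarith
  refine ⟨Q, hQ1, ?_⟩
  have key : ∀ N, (∀ n, ε ^ n * ‖subCoeff a b c q α lam 1 N n‖ ≤ Q ^ N) ∧
      ∀ n, ε ^ n * ‖subCoeff a b c q α lam 1 (N + 1) n‖ ≤ Q ^ (N + 1) := by
    intro N
    induction N with
    | zero =>
      have h0 : ∀ n, ε ^ n * ‖subCoeff a b c q α lam 1 0 n‖ ≤ Q ^ 0 := by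
        rintro (_ | n) <;> simp [subCoeff]
      refine ⟨h0, ?_⟩
      rintro (_ | n)
      · simp only [subCoeff, norm_zero, mul_zero]
        positivity
      · rw [zero_add, subCoeff, norm_mul]
        calc ε ^ (n + 1) * (‖lameA a b c q α lam 0‖ * ‖subCoeff a b c q α lam 1 0 n‖)
            = ε * ‖lameA a b c q α lam 0‖ * (ε ^ n * ‖subCoeff a b c q α lam 1 0 n‖) := by ring
          _ ≤ ε * A * Q ^ 0 := by
            gcongr
            · exact hA' 0
            · exact h0 n
          _ ≤ Q ^ 1 := by
            rw [pow_zero, pow_one]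
            linarith
    | succ N ih =>
      refine ⟨ih.2, ?_⟩
      have hB2 : ∀ n, ε ^ n * ‖lameB a b c α lam (N + 1) * subCoeff a b c q α lam 1 N n‖
          ≤ B * Q ^ N := fun n => by
        rw [norm_mul]
        calc _ = ‖lameB a b c α lam (N + 1)‖ * (ε ^ n * ‖subCoeff a b c q α lam 1 N n‖) := by ring
          _ ≤ _ := by
            gcongr
            · exact hB' _
            · exact ih.1 n
      have hfin : ε * A * Q ^ (N + 1) + B * Q ^ N ≤ Q ^ (N + 1 + 1) := by
        calc _ = (ε * A * Q + B) * Q ^ N := by ring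
          _ ≤ Q ^ 2 * Q ^ N := by gcongr
          _ = _ := by ring
      rintro (_ | n)
      · rw [subCoeff]
        refine (hB2 0).trans (le_trans ?_ hfin)
        have : 0 ≤ ε * A * Q ^ (N + 1) := by positivity
        linarith
      · rw [subCoeff]
        calc _ ≤ ε ^ (n + 1) * (‖lameA a b c q α lam (N + 1) * subCoeff a b c q α lam 1 (N + 1) n‖
              + ‖lameB a b c α lam (N + 1) * subCoeff a b c q α lam 1 N (n + 1)‖) := by
              gcongr
              exact norm_add_le _ _
          _ = ε * ‖lameA a b c q α lam (N + 1)‖ *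
                (ε ^ n * ‖subCoeff a b c q α lam 1 (N + 1) n‖)
              + ε ^ (n + 1) *
                ‖lameB a b c α lam (N + 1) * subCoeff a b c q α lam 1 N (n + 1)‖ := by
              rw [norm_mul]
              ring
          _ ≤ ε * A * Q ^ (N + 1) + B * Q ^ N := by
              refine add_le_add ?_ (hB2 _)
              gcongr
              · exact hA' _
              · exact ih.2 n
          _ ≤ _ := hfin
  exact fun N n => (key N).1 n

theorem subCoeff_ode (hab : a ≠ b) (hac : a ≠ c) (h0 : 0 ≤ lr) (N n : ℕ) :
    (a - b) * (a - c) * ((N + 2 + lr) * (N + 3 / 2 + lr)) * subCoeff a b c q α lr 1 (N + 2) (n + 1)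
      + ((2 * a - b - c) * (N + 1 + lr) ^ 2 + (q - a * α * (α + 1)) / 4)
        * subCoeff a b c q α lr 1 (N + 1) n
      + (N + lr - α / 2) * (N + lr + (α + 1) / 2) * subCoeff a b c q α lr 1 N (n + 1) = 0 ∧
    (a - b) * (a - c) * ((N + 2 + lr) * (N + 3 / 2 + lr)) * subCoeff a b c q α lr 1 (N + 2) 0
      + (N + lr - α / 2) * (N + lr + (α + 1) / 2) * subCoeff a b c q α lr 1 N 0 = 0 := by
  have h1 : a - b ≠ 0 := sub_ne_zero.2 hab
  have h2 : a - c ≠ 0 := sub_ne_zero.2 hac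
  have h3 : (N + 2 + lr : ℂ) ≠ 0 := by
    have := ofReal_add_natCast_ne_zero (x := lr + 2) (by positivity) N
    push_cast at this
    rwa [show (N + 2 + lr : ℂ) = lr + 2 + N by ring]
  have h4 : (N + 3 / 2 + lr : ℂ) ≠ 0 := by
    have := ofReal_add_natCast_ne_zero (x := lr + 3 / 2) (by positivity) N
    push_cast at this
    rwa [show (N + 3 / 2 + lr : ℂ) = lr + 3 / 2 + N by ring]
  have e3 : ((N + 1 : ℕ) + 1 + lr : ℂ) = N + 2 + lr := by
    push_cast
    ring
  have e4 : ((N + 1 : ℕ) + 1 / 2 + lr : ℂ) = N + 3 / 2 + lr := by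
    push_cast
    ring
  rw [subCoeff, subCoeff, lameA, lameB, e3, e4]
  generalize hX : (N + 2 + lr : ℂ) = X at *
  generalize hY : (N + 3 / 2 + lr : ℂ) = Y at *
  constructor
  · field_simp
    push_cast
    ring
  · field_simp
    push_cast
    ring

/-! ### The parts of the Frobenius series and their derivatives -/

/-- The part of the Frobenius series with `n` factors `A`, without the factor `z ^ lam`. -/
noncomputable def frobPart (a b c q α : ℂ) (lr : ℝ) (n : ℕ) : ℂ → ℂ :=
  psum fun N => subCoeff a b c q α lr 1 N n

/-- `(z ∂_z + lam)` applied to `frobPart`. -/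
noncomputable def frobPart₁ (a b c q α : ℂ) (lr : ℝ) (n : ℕ) : ℂ → ℂ :=
  psum fun N => ((N : ℂ) + lr) * subCoeff a b c q α lr 1 N n

/-- `(z ∂_z + lam)²` applied to `frobPart`. -/
noncomputable def frobPart₂ (a b c q α : ℂ) (lr : ℝ) (n : ℕ) : ℂ → ℂ :=
  psum fun N => ((N : ℂ) + lr) * (((N : ℂ) + lr) * subCoeff a b c q α lr 1 N n)

theorem mem_ball_sqrt {D z : ℂ} : z ∈ Metric.ball (0 : ℂ) (Real.sqrt ‖D‖) ↔ ‖z‖ ^ 2 < ‖D‖ := by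
  rw [mem_ball_zero_iff, Real.lt_sqrt (norm_nonneg z)]

theorem frobPart_ode_zero (q α : ℂ) (hab : a ≠ b) (hac : a ≠ c) (hlr : lr = 0 ∨ lr = 1 / 2) {z : ℂ}
    (hz : ‖z‖ ^ 2 < ‖(a - b) * (a - c)‖) :
    ((a - b) * (a - c) + z ^ 2) * frobPart₂ a b c q α lr 0 z
      + 1 / 2 * (z ^ 2 - (a - b) * (a - c)) * frobPart₁ a b c q α lr 0 z
      - z ^ 2 * (α * (α + 1) / 4) * frobPart a b c q α lr 0 z = 0 := by
  have h0 : 0 ≤ lr := by rcases hlr with rfl | rfl <;> norm_num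
  have h := psum_ode (d := fun _ => 0) (D := (a - b) * (a - c)) (s := 0) (k := 0) (α := α)
    (lam := lr) (psConv_subCoeff (lr := lr) q α hab hac h0 0) (fun r _ _ => by simp)
    ?_ ?_ ?_ (mem_ball_zero_iff.1 (mem_ball_sqrt.2 hz))
  · simp only [zero_mul, add_zero, mul_zero] at h
    exact h
  -- The indicial equation `λ(λ - 1/2) = 0`. Level 0 alone needs it, since higher levels have no
  -- constant term.
  · rcases hlr with rfl | rfl <;> norm_num
  · simp [subCoeff]
  · intro N
    have := (subCoeff_ode (q := q) (α := α) hab hac h0 N 0).2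
    linear_combination this

theorem frobPart_ode_succ (q α : ℂ) (hab : a ≠ b) (hac : a ≠ c) (h0 : 0 ≤ lr) (n : ℕ) {z : ℂ}
    (hz : ‖z‖ ^ 2 < ‖(a - b) * (a - c)‖) :
    ((a - b) * (a - c) + z ^ 2) * frobPart₂ a b c q α lr (n + 1) z
      + 1 / 2 * (z ^ 2 - (a - b) * (a - c)) * frobPart₁ a b c q α lr (n + 1) z
      - z ^ 2 * (α * (α + 1) / 4) * frobPart a b c q α lr (n + 1) z
      + z * ((2 * a - b - c) * frobPart₂ a b c q α lr n z
        + (q - a * α * (α + 1)) / 4 * frobPart a b c q α lr n z) = 0 := by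
  refine psum_ode (psConv_subCoeff (lr := lr) q α hab hac h0 (n + 1))
    (psConv_subCoeff (lr := lr) q α hab hac h0 n) ?_ ?_ ?_
    (mem_ball_zero_iff.1 (mem_ball_sqrt.2 hz))
  · simp [subCoeff]
  · have h1 : a - b ≠ 0 := sub_ne_zero.2 hab
    have h2 : a - c ≠ 0 := sub_ne_zero.2 hac
    have h3 := ofReal_add_natCast_ne_zero (x := lr + 1) (by positivity) 0
    have h4 := ofReal_add_natCast_ne_zero (x := lr + 1 / 2) (by positivity) 0
    push_cast at h3 h4
    rw [subCoeff, lameA, Nat.cast_zero, show (0 + 1 + lr : ℂ) = lr + 1 + 0 by ring,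
      show (0 + 1 / 2 + lr : ℂ) = lr + 1 / 2 + 0 by ring, show (1 + lr : ℂ) = lr + 1 + 0 by ring,
      show (1 / 2 + lr : ℂ) = lr + 1 / 2 + 0 by ring]
    generalize (lr + 1 + 0 : ℂ) = X at *
    generalize (lr + 1 / 2 + 0 : ℂ) = Y at *
    field_simp
    ring
  · intro N
    have := (subCoeff_ode (q := q) (α := α) hab hac h0 N n).1
    linear_combination this

theorem frobPart_euler (q α : ℂ) (hab : a ≠ b) (hac : a ≠ c) (h0 : 0 ≤ lr) (n : ℕ) {z : ℂ}
    (hz : ‖z‖ ^ 2 < ‖(a - b) * (a - c)‖) :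
    (DifferentiableAt ℂ (frobPart a b c q α lr n) z ∧
      eulerConj lr (frobPart a b c q α lr n) z = frobPart₁ a b c q α lr n z) ∧
    (DifferentiableAt ℂ (frobPart₁ a b c q α lr n) z ∧
      eulerConj lr (frobPart₁ a b c q α lr n) z = frobPart₂ a b c q α lr n z) := by
  have h1 := psConv_subCoeff (lr := lr) q α hab hac h0 n
  have h2 := h1.add_mul lr
  have hz' := mem_ball_sqrt.2 hz
  have hnhds := Metric.isOpen_ball.mem_nhds hz'
  exact ⟨⟨h1.differentiableOn_and_hasSum_deriv.1.differentiableAt hnhds,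
    h1.eqOn_eulerConj lr (fun _ _ => rfl) hz'⟩,
    h2.differentiableOn_and_hasSum_deriv.1.differentiableAt hnhds,
    h2.eqOn_eulerConj lr (fun _ _ => rfl) hz'⟩

/-- Bounds near the origin. -/
theorem exists_bound_near_zero (a b c q α : ℂ) (lr : ℝ) {ε : ℝ} (hε : 0 ≤ ε) :
    ∃ δ > 0, ∃ M, 0 ≤ M ∧ ∀ z : ℂ, ‖z‖ ≤ δ → ∀ n, ε ^ n * ‖frobPart a b c q α lr n z‖ ≤ M ∧
      ε ^ n * ‖frobPart₁ a b c q α lr n z‖ ≤ M := by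
  obtain ⟨Q, hQ1, hQ⟩ := exists_pow_bound_subCoeff a b c q α lr hε
  have hgeo : PSConv (fun _ => (1 : ℂ)) 1 := fun r h0 h1 => by
    simpa using summable_geometric_of_lt_one h0 h1
  have hgeo₁ := hgeo.add_mul lr
  have hQ0 : 0 < Q := by linarith
  have hg := (hgeo (1 / 2) (by norm_num) (by norm_num))
  have hg₁ := (hgeo₁ (1 / 2) (by norm_num) (by norm_num))
  have hg0 : ∀ β : ℕ → ℂ, 0 ≤ ∑' N : ℕ, ‖β N‖ * (1 / 2 : ℝ) ^ N :=
    fun β => tsum_nonneg fun N => by positivity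
  -- For `|z| ≤ 1/(2Q)` the bound `Q ^ N` leaves `(1/2) ^ N`. The multipliers `1` and `N + λ` then
  -- treat both functions at once.
  have key : ∀ (β : ℕ → ℂ), (Summable fun N => ‖β N‖ * (1 / 2 : ℝ) ^ N) → ∀ z : ℂ,
      ‖z‖ ≤ 1 / (2 * Q) → ∀ n,
      ε ^ n * ‖psum (fun N => β N * subCoeff a b c q α lr 1 N n) z‖
        ≤ ∑' N : ℕ, ‖β N‖ * (1 / 2 : ℝ) ^ N := by
    intro β hβ z hz n
    have h1 : ε ^ n * ‖psum (fun N => β N * subCoeff a b c q α lr 1 N n) z‖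
        = ‖∑' N, (ε : ℂ) ^ n * (β N * subCoeff a b c q α lr 1 N n * z ^ N)‖ := by
      rw [tsum_mul_left, norm_mul, norm_pow, Complex.norm_real, Real.norm_of_nonneg hε]
      rfl
    rw [h1]
    refine tsum_of_norm_bounded hβ.hasSum fun N => ?_
    rw [norm_mul, norm_mul, norm_mul, norm_pow, norm_pow, Complex.norm_real,
      Real.norm_of_nonneg hε]
    calc ε ^ n * (‖β N‖ * ‖subCoeff a b c q α lr 1 N n‖ * ‖z‖ ^ N)
        = ‖β N‖ * ((ε ^ n * ‖subCoeff a b c q α lr 1 N n‖) * ‖z‖ ^ N) := by ring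
      _ ≤ ‖β N‖ * (Q ^ N * (1 / (2 * Q)) ^ N) := by
        gcongr
        exact hQ N n
      _ = ‖β N‖ * (1 / 2 : ℝ) ^ N := by
        rw [← mul_pow]
        congr 2
        field_simp
  refine ⟨1 / (2 * Q), by positivity, (∑' N : ℕ, ‖(1 : ℂ)‖ * (1 / 2 : ℝ) ^ N)
    + ∑' N : ℕ, ‖((N : ℂ) + lr) * 1‖ * (1 / 2 : ℝ) ^ N, add_nonneg (hg0 _) (hg0 _),
    fun z hz n => ⟨?_, ?_⟩⟩
  · have := key (fun _ => 1) hg z hz n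
    simp only [one_mul] at this
    exact this.trans (le_add_of_nonneg_right (hg0 _))
  · have := key (fun N => ((N : ℂ) + lr) * 1) hg₁ z hz n
    simp only [mul_one] at this ⊢
    exact this.trans (le_add_of_nonneg_left (hg0 fun _ => 1))

/-! ### The region of convergence -/

/-- The values of `z = x - a` for which the sum over the number of factors `A` converges. -/
def lameRegion (a b c : ℂ) : Set ℂ :=
  {z | ‖z‖ ^ 2 < ‖(a - b) * (a - c)‖ ∧ ‖(2 * a - b - c) * z‖ < ‖(a - b) * (a - c) + z ^ 2‖}

theorem isOpen_lameRegion (a b c : ℂ) : IsOpen (lameRegion a b c) :=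
  (isOpen_lt (f := fun z : ℂ => ‖z‖ ^ 2) (g := fun _ => ‖(a - b) * (a - c)‖)
    (by fun_prop) (by fun_prop)).inter
  (isOpen_lt (f := fun z : ℂ => ‖(2 * a - b - c) * z‖) (g := fun z => ‖(a - b) * (a - c) + z ^ 2‖)
    (by fun_prop) (by fun_prop))

/-- With `w = z²`, one has `|D + τ² w|² - τ² |D + w|² = (1 - τ²)(|D|² - τ² |w|²)`, which is
nonnegative. Since `|s τ z|` scales exactly by `τ`, the region is star-shaped about `0`. -/
theorem mul_norm_add_sq_le {D z : ℂ} {τ : ℝ} (hz : ‖z‖ ^ 2 ≤ ‖D‖) (h0 : 0 ≤ τ) (h1 : τ ≤ 1) :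
    τ * ‖D + z ^ 2‖ ≤ ‖D + (τ * z) ^ 2‖ := by
  have h2 : ‖z ^ 2‖ ≤ ‖D‖ := by rwa [norm_pow]
  have h3 : ‖z ^ 2‖ ^ 2 ≤ ‖D‖ ^ 2 := by gcongr
  refine abs_le_of_sq_le_sq' ?_ (norm_nonneg _) |>.2
  rw [mul_pow, mul_pow, ← Complex.ofReal_pow]
  generalize z ^ 2 = w at *
  simp only [← Complex.normSq_eq_norm_sq, Complex.normSq_apply, Complex.add_re, Complex.add_im,
    Complex.re_ofReal_mul, Complex.im_ofReal_mul] at h3 ⊢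
  have h4 : τ ^ 2 ≤ 1 := pow_le_one₀ h0 h1
  have h5 : 0 ≤ (1 - τ ^ 2) *
      ((D.re * D.re + D.im * D.im) - τ ^ 2 * (w.re * w.re + w.im * w.im)) := by
    refine mul_nonneg (by linarith) (sub_nonneg.2 (le_trans ?_ h3))
    exact mul_le_of_le_one_left (add_nonneg (mul_self_nonneg _) (mul_self_nonneg _)) h4
  nlinarith

theorem mul_mem_lameRegion (hab : a ≠ b) (hac : a ≠ c) {z : ℂ} (hz : z ∈ lameRegion a b c) {τ : ℝ}
    (h0 : 0 ≤ τ) (h1 : τ ≤ 1) : (τ : ℂ) * z ∈ lameRegion a b c := by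
  have hτ : ‖(τ : ℂ)‖ = τ := by rw [Complex.norm_real, Real.norm_of_nonneg h0]
  refine ⟨lt_of_le_of_lt (pow_le_pow_left₀ (norm_nonneg _) ?_ 2) hz.1, ?_⟩
  · rw [norm_mul, hτ]
    exact mul_le_of_le_one_left (norm_nonneg z) h1
  · rcases h0.eq_or_lt with rfl | h0'
    · simpa using mul_pos (norm_pos_iff.2 (sub_ne_zero.2 hab)) (norm_pos_iff.2 (sub_ne_zero.2 hac))
    · refine lt_of_lt_of_le ?_ (mul_norm_add_sq_le hz.1.le h0 h1)
      rw [mul_left_comm, norm_mul, hτ]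
      exact mul_lt_mul_of_pos_left hz.2 h0'

/-- Geometric bounds for the parts of the Frobenius series, locally uniform in the region. -/
theorem exists_local_geometric_bound (q α : ℂ) (hab : a ≠ b) (hac : a ≠ c)
    (hlr : lr = 0 ∨ lr = 1 / 2) {z₁ : ℂ} (hz₁ : z₁ ∈ lameRegion a b c) :
    ∃ δ > 0, Metric.ball z₁ δ ⊆ lameRegion a b c ∧ ∃ u : ℕ → ℝ, Summable u ∧
      ∀ z ∈ Metric.ball z₁ δ, ∀ n, ‖frobPart a b c q α lr n z‖ ≤ u n ∧
        ‖frobPart₁ a b c q α lr n z‖ ≤ u n ∧ ‖frobPart₂ a b c q α lr n z‖ ≤ u n := by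
  have h0 : 0 ≤ lr := by rcases hlr with rfl | rfl <;> norm_num
  set D := (a - b) * (a - c) with hD
  set s := 2 * a - b - c with hs
  obtain ⟨δ, hδ, hball⟩ := Metric.nhds_basis_closedBall.mem_iff.1
    ((isOpen_lameRegion a b c).mem_nhds hz₁)
  -- `S` parametrises all segments from `0` to points of the ball. Its compactness gives one
  -- positive gap `m₀` valid on all of them.
  set S : Set (ℝ × ℂ) := Set.Icc 0 1 ×ˢ Metric.closedBall z₁ δ with hS
  have hScomp : IsCompact S := isCompact_Icc.prod (isCompact_closedBall z₁ δ)
  obtain ⟨⟨τ', z'⟩, hmem, hmin⟩ := hScomp.exists_isMinOn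
    (f := fun p : ℝ × ℂ => ‖D + (p.1 * p.2) ^ 2‖ - ‖s * (p.1 * p.2)‖)
    ⟨(0, z₁), ⟨le_rfl, zero_le_one⟩, Metric.mem_closedBall_self hδ.le⟩ (by fun_prop)
  set m₀ := ‖D + (τ' * z') ^ 2‖ - ‖s * (τ' * z')‖ with hm₀
  have hm₀pos : 0 < m₀ :=
    sub_pos.2 (mul_mem_lameRegion hab hac (hball hmem.2) hmem.1.1 hmem.1.2).2
  set E := ‖s‖ * Real.sqrt ‖D‖ with hE
  have hE0 : 0 ≤ E := by positivity
  -- Since `E` bounds `|s τ z|`, raising the weight from 1 to `ε` uses at most half of the gap `m₀`.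
  set ε := 1 + m₀ / (2 * (E + 1)) with hε
  have hε1 : 1 < ε := by
    have : 0 < m₀ / (2 * (E + 1)) := by positivity
    linarith
  have hε0 : 0 < ε := by linarith
  obtain ⟨δ₀, hδ₀, M, hM, hnear⟩ := exists_bound_near_zero a b c q α lr hε0.le
  -- As `|z| ≤ √|D|`, the starting point `τ₀ z` lies in the disc where the bounds near the origin
  -- hold.
  set τ₀ := min 1 (δ₀ / (Real.sqrt ‖D‖ + 1)) with hτ₀
  have hτ₀pos : 0 < τ₀ := lt_min one_pos (by positivity)
  have hτ₀1 : τ₀ ≤ 1 := min_le_left _ _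
  set C := (‖D‖ + ‖D‖ * ‖α * (α + 1) / 4‖
    + Real.sqrt ‖D‖ * (ε * ‖(q - a * α * (α + 1)) / 4‖)) / (m₀ / 2) with hC
  have hC0 : 0 ≤ C := by positivity
  set B := M * Real.exp ((1 + C + ‖(lr : ℂ)‖) / τ₀) with hB
  have hB0 : 0 ≤ B := by positivity
  refine ⟨δ, hδ, Metric.ball_subset_closedBall.trans hball, fun n => (1 + C) * B * (1 / ε) ^ n,
    (summable_geometric_of_lt_one (by positivity) ((div_lt_one hε0).2 hε1)).mul_left _,
    fun z hz n => ?_⟩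
  have hzc := Metric.ball_subset_closedBall hz
  have hzr := hball hzc
  have hzD : ‖z‖ ≤ Real.sqrt ‖D‖ := Real.le_sqrt_of_sq_le hzr.1.le
  have hτ₀z : ‖(τ₀ : ℂ) * z‖ ≤ δ₀ := by
    rw [norm_mul, Complex.norm_real, Real.norm_of_nonneg hτ₀pos.le]
    calc τ₀ * ‖z‖ ≤ δ₀ / (Real.sqrt ‖D‖ + 1) * (Real.sqrt ‖D‖ + 1) := by
          gcongr
          · exact min_le_right _ _
          · linarith
      _ = δ₀ := by field_simp
  obtain ⟨h1, h2, h3⟩ := weighted_ray_bound (D := D) (s := s)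
    (k := (q - a * α * (α + 1)) / 4) (κ := α * (α + 1) / 4) (lam := lr) (z := z)
    (p := frobPart a b c q α lr) (t₁ := frobPart₁ a b c q α lr) (t₂ := frobPart₂ a b c q α lr)
    hε0 (half_pos hm₀pos) hτ₀pos hτ₀1 hzr.1 (fun τ h1 h2 => by
      have hτ0 := hτ₀pos.le.trans h1
      have h3 : m₀ ≤ ‖D + (τ * z) ^ 2‖ - ‖s * (τ * z)‖ := hmin (a := (τ, z)) ⟨⟨hτ0, h2⟩, hzc⟩
      have h4 : ‖s * (τ * z)‖ ≤ E := by
        rw [norm_mul, norm_mul, Complex.norm_real, Real.norm_of_nonneg hτ0, hE]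
        gcongr
        exact (mul_le_of_le_one_left (norm_nonneg z) h2).trans hzD
      have h5 : m₀ / (2 * (E + 1)) * ‖s * (τ * z)‖ ≤ m₀ / 2 := by
        calc m₀ / (2 * (E + 1)) * ‖s * (τ * z)‖ ≤ m₀ / (2 * (E + 1)) * (E + 1) := by
              gcongr
              linarith
          _ = m₀ / 2 := by field_simp
      rw [hε, add_mul, one_mul]
      linarith)
    (fun z hz => frobPart_ode_zero q α hab hac hlr hz)
    (fun n z hz => frobPart_ode_succ q α hab hac h0 n hz)
    (fun n z hz => (frobPart_euler q α hab hac h0 n hz).1)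
    (fun n z hz => (frobPart_euler q α hab hac h0 n hz).2)
    hM (fun n => (hnear _ hτ₀z n).1) (fun n => (hnear _ hτ₀z n).2) n
  change _ ≤ B at h1 h2
  change _ ≤ C * B at h3
  have key : ∀ x : ℝ, ε ^ n * x ≤ (1 + C) * B → x ≤ (1 + C) * B * (1 / ε) ^ n := fun x hx => by
    rw [one_div, inv_pow, ← div_eq_mul_inv, le_div_iff₀ (by positivity)]
    linarith
  have hCB : 0 ≤ C * B := by positivity
  refine ⟨key _ ?_, key _ ?_, key _ ?_⟩
  · exact h1.trans (by linarith)
  · exact h2.trans (by linarith)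
  · exact h3.trans (by linarith)

end

/-! ### Termwise differentiation and the factor `z ^ λ` -/

theorem eulerConj_tsum {V : Set ℂ} {F : ℕ → ℂ → ℂ} (β : ℂ)
    (hloc : ∀ z₁ ∈ V, ∃ δ > 0, Metric.ball z₁ δ ⊆ V ∧ ∃ u : ℕ → ℝ, Summable u ∧
      ∀ z ∈ Metric.ball z₁ δ, ∀ n, ‖F n z‖ ≤ u n)
    (hd : ∀ n, ∀ z ∈ V, DifferentiableAt ℂ (F n) z) {z : ℂ} (hz : z ∈ V) :
    DifferentiableAt ℂ (fun z => ∑' n, F n z) z ∧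
      HasSum (fun n => F n z) (∑' n, F n z) ∧
      HasSum (fun n => eulerConj β (F n) z) (eulerConj β (fun z => ∑' n, F n z) z) := by
  obtain ⟨δ, hδ, hsub, u, hu, hF⟩ := hloc z hz
  have hzb := Metric.mem_ball_self (x := z) hδ
  have hdo : ∀ n, DifferentiableOn ℂ (F n) (Metric.ball z δ) :=
    fun n w hw => (hd n w (hsub hw)).differentiableWithinAt
  have h0 : HasSum (fun n => F n z) (∑' n, F n z) :=
    (Summable.of_norm_bounded hu fun n => hF z hzb n).hasSum
  refine ⟨(Complex.differentiableOn_tsum_of_summable_norm hu hdo Metric.isOpen_ball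
    fun n w hw => hF w hw n).differentiableAt (Metric.isOpen_ball.mem_nhds hzb), h0, ?_⟩
  exact ((Complex.hasSum_deriv_of_summable_norm hu hdo Metric.isOpen_ball
    (fun n w hw => hF w hw n) hzb).mul_left z).add (h0.mul_left β)

theorem IsLameSolutionAt.congr {a b c q α : ℂ} {Y Y' : ℂ → ℂ} {x : ℂ}
    (h : IsLameSolutionAt a b c q α Y x) (he : Y' =ᶠ[𝓝 x] Y) : IsLameSolutionAt a b c q α Y' x := by
  refine ⟨h.1.congr he.symm, ?_⟩
  rw [he.deriv.deriv_eq, he.deriv_eq, he.eq_of_nhds]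
  exact h.2

/-- A continuous local right inverse of `exp` is differentiable because `exp` has nonvanishing
derivative. -/
theorem hasDerivAt_of_exp_eq {U : Set ℂ} (hU : IsOpen U) {L : ℂ → ℂ} (hLcont : ContinuousOn L U)
    (hLexp : ∀ z ∈ U, Complex.exp (L z) = z) {z : ℂ} (hz : z ∈ U) : HasDerivAt L z⁻¹ z := by
  have h := HasDerivAt.of_local_left_inverse (f := Complex.exp) (g := L) (a := z)
    (hLcont.continuousAt (hU.mem_nhds hz)) (Complex.hasDerivAt_exp (L z)) (Complex.exp_ne_zero _)
    (by filter_upwards [hU.mem_nhds hz] with w hw using hLexp w hw)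
  rwa [hLexp z hz] at h

theorem hasDerivAt_exp_mul {lam : ℂ} {L f : ℂ → ℂ} {z : ℂ} (hL : HasDerivAt L z⁻¹ z) (hz : z ≠ 0)
    (hf : DifferentiableAt ℂ f z) :
    HasDerivAt (fun z => Complex.exp (lam * L z) * f z)
      (Complex.exp (lam * L z) * eulerConj lam f z / z) z := by
  refine ((hL.const_mul lam).cexp.mul hf.hasDerivAt).congr_deriv ?_
  rw [eulerConj]
  field_simp
  ring

section

variable {a b c q α : ℂ} {lr : ℝ}

/-! ### The sum over the number of factors `A` -/

/-- The Frobenius solution without the factor `z ^ lam`, summed by the number of factors `A`. -/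
noncomputable def frobSum (a b c q α : ℂ) (lr : ℝ) (z : ℂ) : ℂ := ∑' n, frobPart a b c q α lr n z

/-- `(z ∂_z + lam)` applied to `frobSum`. -/
noncomputable def frobSum₁ (a b c q α : ℂ) (lr : ℝ) (z : ℂ) : ℂ := ∑' n, frobPart₁ a b c q α lr n z

/-- Adding the level equations, the odd part of level `n` is paired with the even part of level `n +
1`; level 0 satisfies the even equation alone. The total is the full Lamé operator applied to the
sum. -/
theorem frobSum_facts (q α : ℂ) (hab : a ≠ b) (hac : a ≠ c) (hlr : lr = 0 ∨ lr = 1 / 2) {z : ℂ}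
    (hz : z ∈ lameRegion a b c) :
    (DifferentiableAt ℂ (frobSum a b c q α lr) z ∧
      eulerConj lr (frobSum a b c q α lr) z = frobSum₁ a b c q α lr z ∧
      DifferentiableAt ℂ (frobSum₁ a b c q α lr) z) ∧
    HasSum (fun n => frobPart a b c q α lr n z) (frobSum a b c q α lr z) ∧
    ((a - b) * (a - c) + z ^ 2) * eulerConj lr (frobSum₁ a b c q α lr) z
      + 1 / 2 * (z ^ 2 - (a - b) * (a - c)) * frobSum₁ a b c q α lr z
      - z ^ 2 * (α * (α + 1) / 4) * frobSum a b c q α lr z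
      + z * ((2 * a - b - c) * eulerConj lr (frobSum₁ a b c q α lr) z
        + (q - a * α * (α + 1)) / 4 * frobSum a b c q α lr z) = 0 := by
  have h0 : 0 ≤ lr := by rcases hlr with rfl | rfl <;> norm_num
  have hloc := fun z₁ (hz₁ : z₁ ∈ lameRegion a b c) =>
    exists_local_geometric_bound q α hab hac hlr hz₁
  have he := fun n z (hz : z ∈ lameRegion a b c) => frobPart_euler q α hab hac h0 n hz.1
  obtain ⟨d0, s0, s1⟩ := eulerConj_tsum (lr : ℂ)
    (F := frobPart a b c q α lr) (fun z₁ hz₁ => by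
      obtain ⟨δ, hδ, hs, u, hu, h⟩ := hloc z₁ hz₁
      exact ⟨δ, hδ, hs, u, hu, fun z hz n => (h z hz n).1⟩)
    (fun n z hz => (he n z hz).1.1) hz
  obtain ⟨d1, s1', s2⟩ := eulerConj_tsum (lr : ℂ)
    (F := frobPart₁ a b c q α lr) (fun z₁ hz₁ => by
      obtain ⟨δ, hδ, hs, u, hu, h⟩ := hloc z₁ hz₁
      exact ⟨δ, hδ, hs, u, hu, fun z hz n => (h z hz n).2.1⟩)
    (fun n z hz => (he n z hz).2.1) hz
  have s1e := ((hasSum_congr fun n => (he n z hz).1.2).1 s1).unique s1'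
  have s2' := (hasSum_congr fun n => (he n z hz).2.2).1 s2
  refine ⟨⟨d0, s1e, d1⟩, s0, ?_⟩
  have hE := (((s2'.mul_left ((a - b) * (a - c) + z ^ 2)).add
    (s1'.mul_left (1 / 2 * (z ^ 2 - (a - b) * (a - c))))).sub
    (s0.mul_left (z ^ 2 * (α * (α + 1) / 4))))
  have hE' := (hasSum_nat_add_iff' 1).2 hE
  have hK := ((s2'.mul_left (2 * a - b - c)).add
    (s0.mul_left ((q - a * α * (α + 1)) / 4))).mul_left z
  have hz0 := (hE'.add hK).unique ((hasSum_congr (g := fun _ => (0 : ℂ)) fun n =>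
    frobPart_ode_succ q α hab hac h0 n hz.1).2 hasSum_zero)
  rw [Finset.sum_range_one, frobPart_ode_zero q α hab hac hlr hz.1, sub_zero] at hz0
  exact hz0

theorem isLameSolutionAt_frobSum (q α c₀ : ℂ) (hab : a ≠ b) (hac : a ≠ c)
    (hlr : lr = 0 ∨ lr = 1 / 2) {U : Set ℂ} (hU : IsOpen U) {L : ℂ → ℂ} (hLcont : ContinuousOn L U)
    (hLexp : ∀ z ∈ U, Complex.exp (L z) = z) {x : ℂ} (hx : x - a ∈ U)
    (hxr : x - a ∈ lameRegion a b c) :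
    IsLameSolutionAt a b c q α
      (fun x' => c₀ * (Complex.exp (lr * L (x' - a)) * frobSum a b c q α lr (x' - a))) x := by
  set V : Set ℂ := {x' | x' - a ∈ U ∩ lameRegion a b c} with hV
  have hVo : IsOpen V := (hU.inter (isOpen_lameRegion a b c)).preimage (by fun_prop)
  have hne : ∀ z ∈ U, z ≠ 0 := fun z hz => hLexp z hz ▸ Complex.exp_ne_zero _
  have h1 : ∀ x' ∈ V, HasDerivAt
      (fun x' => c₀ * (Complex.exp (lr * L (x' - a)) * frobSum a b c q α lr (x' - a)))
      (c₀ * (Complex.exp (lr * L (x' - a)) * frobSum₁ a b c q α lr (x' - a) / (x' - a))) x' := by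
    intro x' hx'
    obtain ⟨⟨d0, e1, d1⟩, -, -⟩ := frobSum_facts q α hab hac hlr hx'.2
    have h := hasDerivAt_exp_mul (lam := lr) (hasDerivAt_of_exp_eq hU hLcont hLexp hx'.1)
      (hne _ hx'.1) d0
    rw [e1] at h
    exact (h.comp_sub_const x' a).const_mul c₀
  have hxV : x ∈ V := ⟨hx, hxr⟩
  obtain ⟨⟨d0, e1, d1⟩, -, hode⟩ := frobSum_facts q α hab hac hlr hxr
  have hz0 := hne _ hx
  have h2 : HasDerivAt
      (fun x' => c₀ * (Complex.exp (lr * L (x' - a)) * frobSum₁ a b c q α lr (x' - a) / (x' - a)))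
      (c₀ * ((Complex.exp (lr * L (x - a)) * eulerConj lr (frobSum₁ a b c q α lr) (x - a) / (x - a)
        * (x - a) - Complex.exp (lr * L (x - a)) * frobSum₁ a b c q α lr (x - a) * 1)
        / (x - a) ^ 2)) x := by
    have h := hasDerivAt_exp_mul (lam := lr) (hasDerivAt_of_exp_eq hU hLcont hLexp hx) hz0 d1
    exact ((h.comp_sub_const x a).div ((hasDerivAt_id x).sub_const a) hz0).const_mul c₀
  refine ⟨?_, ?_⟩
  · exact DifferentiableOn.analyticAt
      (fun x' hx' => (h1 x' hx').differentiableAt.differentiableWithinAt) (hVo.mem_nhds hxV)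
  · have h3 : deriv (fun x' => c₀ *
        (Complex.exp (lr * L (x' - a)) * frobSum a b c q α lr (x' - a))) =ᶠ[𝓝 x]
        fun x' => c₀ * (Complex.exp (lr * L (x' - a)) * frobSum₁ a b c q α lr (x' - a)
          / (x' - a)) := by
      filter_upwards [hVo.mem_nhds hxV] with x' hx' using (h1 x' hx').deriv
    rw [h3.deriv_eq, h2.deriv, (h1 x hxV).deriv]
    beta_reduce
    have hprod : (x - b) * (x - c) = (a - b) * (a - c) + (x - a) ^ 2
        + (2 * a - b - c) * (x - a) := by ring
    -- Vanishing would mean `D + z² = -s z`, which the strict inequality of the region excludes.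
    have hprod0 : (x - b) * (x - c) ≠ 0 := fun h => by
      rw [hprod, add_eq_zero_iff_eq_neg] at h
      have := hxr.2
      rw [h, norm_neg] at this
      exact lt_irrefl _ this
    have hb : x - b ≠ 0 := left_ne_zero_of_mul hprod0
    have hc : x - c ≠ 0 := right_ne_zero_of_mul hprod0
    generalize eulerConj (lr : ℂ) (frobSum₁ a b c q α lr) (x - a) = S₂ at *
    generalize frobSum₁ a b c q α lr (x - a) = S₁ at *
    generalize frobSum a b c q α lr (x - a) = S₀ at *
    generalize Complex.exp (lr * L (x - a)) = e at *
    -- Lamé's equation multiplied by `(x-a)² (x-b)(x-c)`, with `y' = e S₁/z` and `y'' = e (S₂ -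
    -- S₁)/z²` and the common factor `c₀ e` removed.
    have key : (x - b) * (x - c) * (S₂ - S₁)
        + 1 / 2 * ((x - b) * (x - c) + (x - a) * (x - c) + (x - a) * (x - b)) * S₁
        + (-α * (α + 1) * x + q) / 4 * (x - a) * S₀ = 0 := by
      linear_combination hode
    field_simp
    linear_combination 8 * c₀ * e * key

end

section

variable {a b c q α : ℂ} {lr : ℝ}

/-! ### The Frobenius series -/

theorem hasSum_subCoeff (a b c q α lam c₀ : ℂ) (N : ℕ) :
    HasSum (fun n => subCoeff a b c q α lam c₀ N n) (frobCoeff a b c q α lam c₀ N) := by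
  have key : ∀ N, HasSum (fun n => subCoeff a b c q α lam c₀ N n)
        (frobCoeff a b c q α lam c₀ N) ∧
      HasSum (fun n => subCoeff a b c q α lam c₀ (N + 1) n)
        (frobCoeff a b c q α lam c₀ (N + 1)) := by
    intro N
    induction N with
    | zero =>
      have h0 : HasSum (fun n => subCoeff a b c q α lam c₀ 0 n) (frobCoeff a b c q α lam c₀ 0) := by
        have h := hasSum_single (f := fun n => subCoeff a b c q α lam c₀ 0 n) 0 (by
          rintro (_ | n) hn
          · exact absurd rfl hn
          · simp [subCoeff])
        simpa [frobCoeff, subCoeff] using h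
      refine ⟨h0, (hasSum_nat_add_iff' 1).1 ?_⟩
      simpa [subCoeff, frobCoeff] using h0.mul_left (lameA a b c q α lam 0)
    | succ N ih =>
      refine ⟨ih.2, (hasSum_nat_add_iff' 1).1 ?_⟩
      have h1 := (ih.2.mul_left (lameA a b c q α lam (N + 1))).add
        (((hasSum_nat_add_iff' 1).2 ih.1).mul_left (lameB a b c α lam (N + 1)))
      rw [Finset.sum_range_one] at h1 ⊢
      simp only [subCoeff, frobCoeff] at h1 ⊢
      convert! h1 using 1
      ring
  exact (key N).1

theorem frobCoeff_eq_mul (a b c q α lam c₀ : ℂ) (N : ℕ) :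
    frobCoeff a b c q α lam c₀ N = c₀ * frobCoeff a b c q α lam 1 N := by
  have h := (hasSum_subCoeff a b c q α lam 1 N).mul_left c₀
  exact (hasSum_subCoeff a b c q α lam c₀ N).unique
    ((hasSum_congr fun n => (subCoeff_eq_mul a b c q α lam c₀ N n).symm).1 h)

/-- A three-term recurrence whose coefficients tend to those with characteristic roots `-P`, `-Q`
has solutions growing at most like the larger root. -/
theorem psConv_of_three_term {C A B : ℕ → ℂ} {P Q : ℂ} {R : ℝ}
    (hrec : ∀ N, C (N + 2) = A N * C (N + 1) + B N * C N)
    (hA : Tendsto A atTop (𝓝 (-(P + Q)))) (hB : Tendsto B atTop (𝓝 (-(P * Q))))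
    (hP : ‖P‖ * R ≤ 1) (hQ : ‖Q‖ * R ≤ 1) : PSConv C R := by
  intro r hr0 hrR
  have hR : 0 < R := hr0.trans_lt hrR
  set θ := r / R with hθ
  have hθ0 : 0 ≤ θ := by positivity
  have hθ1 : θ < 1 := (div_lt_one hR).2 hrR
  have hPr : ‖P‖ * r ≤ θ := by
    rw [hθ, le_div_iff₀ hR]
    nlinarith [norm_nonneg P]
  have hQr : ‖Q‖ * r ≤ θ := by
    rw [hθ, le_div_iff₀ hR]
    nlinarith [norm_nonneg Q]
  set κ := (1 - θ) / 4 with hκ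
  have hκ0 : 0 < κ := by
    rw [hκ]
    linarith
  set x : ℕ → ℝ := fun N => ‖C N‖ * r ^ N with hx
  -- Splitting off the root `-P`: the combination `C (N+1) + P C N` satisfies a first-order
  -- recurrence with multiplier `-Q`, up to errors that tend to 0.
  set f : ℕ → ℝ := fun N => ‖C (N + 1) + P * C N‖ * r ^ (N + 1) with hf
  have hx0 : ∀ N, 0 ≤ x N := fun N => by positivity
  have hf0 : ∀ N, 0 ≤ f N := fun N => by positivity
  have hxrec : ∀ N, x (N + 1) ≤ f N + θ * x N := fun N => by
    have h1 : ‖C (N + 1)‖ ≤ ‖C (N + 1) + P * C N‖ + ‖P‖ * ‖C N‖ := by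
      rw [← norm_mul]
      calc ‖C (N + 1)‖ = ‖C (N + 1) + P * C N - P * C N‖ := by rw [add_sub_cancel_right]
        _ ≤ _ := norm_sub_le _ _
    calc x (N + 1) ≤ (‖C (N + 1) + P * C N‖ + ‖P‖ * ‖C N‖) * r ^ (N + 1) := by
          simp only [hx]
          gcongr
      _ = f N + ‖P‖ * r * x N := by
          simp only [hx, hf]
          ring
      _ ≤ _ := by
          gcongr
  set d : ℕ → ℝ := fun N => ‖A N + (P + Q)‖ * r with hd
  set d' : ℕ → ℝ := fun N => ‖B N + P * Q‖ * r ^ 2 with hd'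
  have hfrec : ∀ N, f (N + 1) ≤ θ * f N + d N * x (N + 1) + d' N * x N := fun N => by
    have h1 : ‖C (N + 2) + P * C (N + 1)‖ ≤ ‖Q‖ * ‖C (N + 1) + P * C N‖
        + ‖A N + (P + Q)‖ * ‖C (N + 1)‖ + ‖B N + P * Q‖ * ‖C N‖ := by
      rw [← norm_mul, ← norm_mul, ← norm_mul, ← norm_neg (Q * _)]
      have e : C (N + 2) + P * C (N + 1) = -(Q * (C (N + 1) + P * C N))
          + (A N + (P + Q)) * C (N + 1) + (B N + P * Q) * C N := by
        rw [hrec]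
        ring
      rw [e]
      exact norm_add₃_le
    calc f (N + 1) ≤ (‖Q‖ * ‖C (N + 1) + P * C N‖
        + ‖A N + (P + Q)‖ * ‖C (N + 1)‖ + ‖B N + P * Q‖ * ‖C N‖) * r ^ (N + 2) := by
          simp only [hf]
          gcongr
      _ = ‖Q‖ * r * f N + d N * x (N + 1) + d' N * x N := by
          simp only [hf, hx, hd, hd']
          ring
      _ ≤ _ := by
          gcongr
  have hdlim : Tendsto d atTop (𝓝 0) := by
    have := ((hA.add_const (P + Q)).norm).mul_const r
    simpa using this
  have hdlim' : Tendsto d' atTop (𝓝 0) := by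
    have := ((hB.add_const (P * Q)).norm).mul_const (r ^ 2)
    simpa using this
  -- The large weight `κ⁻¹` on `f` pays for the coupling of `f` into `x`. The combined quantity then
  -- contracts by `θ + 2κ = (1 + θ)/2 < 1`.
  have hsum : Summable fun N => x N + κ⁻¹ * f N := by
    refine summable_of_eventually_le_add_mul (e := fun _ => 0) (θ := θ + 2 * κ)
      (fun N => add_nonneg (hx0 N) (mul_nonneg (by positivity) (hf0 N))) (fun _ => le_rfl)
      (by simp) (by rw [hκ]; linarith) ?_
    filter_upwards [hdlim.eventually_lt_const (show 0 < min κ (κ ^ 2) by positivity),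
      hdlim'.eventually_lt_const (show 0 < κ ^ 2 by positivity)] with N h1 h2
    have h3 : d N ≤ κ := (h1.trans_le (min_le_left _ _)).le
    have h4 : d N ≤ κ ^ 2 := (h1.trans_le (min_le_right _ _)).le
    have hd0 : 0 ≤ d N := by positivity
    have hd0' : 0 ≤ d' N := by positivity
    have h5 : f (N + 1) ≤ (θ + κ) * f N + 2 * κ ^ 2 * x N := by
      calc f (N + 1) ≤ θ * f N + d N * x (N + 1) + d' N * x N := hfrec N
        _ ≤ θ * f N + d N * (f N + θ * x N) + κ ^ 2 * x N := by
            gcongr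
            exact hxrec N
        _ = θ * f N + d N * f N + d N * (θ * x N) + κ ^ 2 * x N := by ring
        _ ≤ θ * f N + κ * f N + κ ^ 2 * (1 * x N) + κ ^ 2 * x N := by
            have := hx0 N
            have := hf0 N
            gcongr
        _ = _ := by ring
    calc x (N + 1) + κ⁻¹ * f (N + 1)
        ≤ (f N + θ * x N) + κ⁻¹ * ((θ + κ) * f N + 2 * κ ^ 2 * x N) := by
          gcongr
          exact hxrec N
      _ = 0 + (θ + 2 * κ) * (x N + κ⁻¹ * f N) := by
          field_simp
          ring
      _ ≤ _ := le_rfl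
  refine hsum.of_nonneg_of_le hx0 fun N => le_add_of_nonneg_right ?_
  have := hf0 N
  positivity

/-- The limiting recurrence has characteristic roots `-1/(a-b)` and `-1/(a-c)`, corresponding to the
singularities `x = b` and `x = c`. -/
theorem psConv_frobCoeff (q α lam : ℂ) (hab : a ≠ b) (hac : a ≠ c) :
    PSConv (frobCoeff a b c q α lam 1) (min ‖a - b‖ ‖a - c‖) := by
  have h1 : a - b ≠ 0 := sub_ne_zero.2 hab
  have h2 : a - c ≠ 0 := sub_ne_zero.2 hac
  have hA := (tendsto_add_atTop_iff_nat 1).2 (tendsto_lameA a b c q α lam)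
  have hB := (tendsto_add_atTop_iff_nat 1).2 (tendsto_lameB a b c α lam)
  refine psConv_of_three_term (A := fun N => lameA a b c q α lam (N + 1))
    (B := fun N => lameB a b c α lam (N + 1)) (P := (a - b)⁻¹) (Q := (a - c)⁻¹)
    (fun N => by rw [frobCoeff]) ?_ ?_ ?_ ?_
  · convert! hA using 2
    field_simp
    ring
  · convert! hB using 2
    field_simp
  · rw [norm_inv, inv_mul_le_iff₀ (norm_pos_iff.2 h1), mul_one]
    exact min_le_left _ _
  · rw [norm_inv, inv_mul_le_iff₀ (norm_pos_iff.2 h2), mul_one]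
    exact min_le_right _ _

/-- The weight `ε = 2` bounds the double series by `(1/2)^N (1/2)^n` near the origin, so the two
summations can be exchanged. -/
theorem psum_frobCoeff_eq_near_zero (a b c q α : ℂ) (lr : ℝ) :
    ∃ δ > 0, ∀ z : ℂ, ‖z‖ ≤ δ → psum (frobCoeff a b c q α lr 1) z = frobSum a b c q α lr z := by
  obtain ⟨Q, hQ1, hQ⟩ := exists_pow_bound_subCoeff a b c q α lr (ε := 2) (by norm_num)
  refine ⟨1 / (2 * Q), by positivity, fun z hz => ?_⟩
  have hs : Summable (Function.uncurry fun N n : ℕ => subCoeff a b c q α lr 1 N n * z ^ N) := by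
    have hg := summable_geometric_of_lt_one (r := (1 / 2 : ℝ)) (by norm_num) (by norm_num)
    refine Summable.of_norm_bounded (hg.mul_of_nonneg hg (fun _ => by positivity)
      (fun _ => by positivity)) ?_
    rintro ⟨N, n⟩
    simp only [Function.uncurry_apply_pair]
    rw [norm_mul, norm_pow]
    calc ‖subCoeff a b c q α lr 1 N n‖ * ‖z‖ ^ N
        = (2 ^ n * ‖subCoeff a b c q α lr 1 N n‖) * ‖z‖ ^ N * (1 / 2) ^ n := by
          rw [one_div, inv_pow]
          field_simp
      _ ≤ Q ^ N * (1 / (2 * Q)) ^ N * (1 / 2) ^ n := by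
          gcongr
          exact hQ N n
      _ = (1 / 2) ^ N * (1 / 2) ^ n := by
          rw [← mul_pow]
          congr 2
          field_simp
  have h1 : psum (frobCoeff a b c q α lr 1) z
      = ∑' N, ∑' n, subCoeff a b c q α lr 1 N n * z ^ N :=
    tsum_congr fun N => by rw [tsum_mul_right, (hasSum_subCoeff a b c q α lr 1 N).tsum_eq]
  rw [h1, ← hs.tsum_comm]
  rfl

/-- Both sides are analytic on the star-shaped, hence connected, intersection of the region with the
disc, and they agree near `0`. -/
theorem psum_frobCoeff_eq_frobSum (q α : ℂ) (hab : a ≠ b) (hac : a ≠ c)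
    (hlr : lr = 0 ∨ lr = 1 / 2) {z : ℂ} (hz : z ∈ lameRegion a b c)
    (hz' : ‖z‖ < min ‖a - b‖ ‖a - c‖) :
    psum (frobCoeff a b c q α lr 1) z = frobSum a b c q α lr z := by
  set ρ := min ‖a - b‖ ‖a - c‖ with hρ
  set V := lameRegion a b c ∩ Metric.ball 0 ρ with hV
  have hVo : IsOpen V := (isOpen_lameRegion a b c).inter Metric.isOpen_ball
  have hzV : z ∈ V := ⟨hz, mem_ball_zero_iff.2 hz'⟩
  have hstar : StarConvex ℝ 0 V := by
    intro w hw s t hs ht hst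
    rw [smul_zero, zero_add, Complex.real_smul]
    have ht1 : t ≤ 1 := by linarith
    refine ⟨mul_mem_lameRegion hab hac hw.1 ht ht1, ?_⟩
    rw [mem_ball_zero_iff, norm_mul, Complex.norm_real, Real.norm_of_nonneg ht]
    exact (mul_le_of_le_one_left (norm_nonneg w) ht1).trans_lt (mem_ball_zero_iff.1 hw.2)
  have h0V : (0 : ℂ) ∈ V := by simpa using hstar hzV zero_le_one le_rfl (add_zero 1)
  have hpre : IsPreconnected V :=
    (hstar.isPathConnected h0V).isConnected.isPreconnected
  have hf : AnalyticOnNhd ℂ (psum (frobCoeff a b c q α lr 1)) V :=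
    ((psConv_frobCoeff q α lr hab hac).differentiableOn_and_hasSum_deriv.1.mono
      Set.inter_subset_right).analyticOnNhd hVo
  have hg : AnalyticOnNhd ℂ (frobSum a b c q α lr) V :=
    DifferentiableOn.analyticOnNhd (fun w hw =>
      (frobSum_facts q α hab hac hlr hw.1).1.1.differentiableWithinAt) hVo
  obtain ⟨δ, hδ, heq⟩ := psum_frobCoeff_eq_near_zero a b c q α lr
  refine hf.eqOn_of_preconnected_of_eventuallyEq hg hpre h0V ?_ hzV
  filter_upwards [Metric.ball_mem_nhds (0 : ℂ) hδ] with w hw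
  exact heq w (mem_ball_zero_iff.1 hw).le

end

end

/-! ### The main theorem -/

theorem mainTheorem2 (a b c q α lam c₀ : ℂ) (hab : a ≠ b) (hac : a ≠ c)
    (hlam : lam = 0 ∨ lam = 1 / 2)
    (U : Set ℂ) (hU : IsOpen U) (L : ℂ → ℂ) (hLcont : ContinuousOn L U)
    (hLexp : ∀ z ∈ U, Complex.exp (L z) = z) :
    -- admissible contours exist
    (∃ ρ : ℕ → ℂ → ℝ → ℝ → ℝ, AdmissibleContours ρ) ∧
    -- the innermost series converges and is a hypergeometric function
    (∀ w : ℂ, ‖w‖ < 1 →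
      Summable (fun i : ℕ => (ascPochhammer ℂ i).eval (-α / 4 + lam / 2)
          * (ascPochhammer ℂ i).eval (α / 4 + 1 / 4 + lam / 2)
        / ((ascPochhammer ℂ i).eval (1 + lam / 2) * (ascPochhammer ℂ i).eval (3 / 4 + lam / 2))
        * w ^ i) ∧
      lameSeries α lam w = ₂F₁ (-α / 4 + lam / 2) (α / 4 + 1 / 4 + lam / 2) (3 / 4 + lam) w) ∧
    ∀ ρ : ℕ → ℂ → ℝ → ℝ → ℝ, AdmissibleContours ρ →
      -- all derivatives and integrals in the nested formula exist
      (∀ n : ℕ, DifferentiableOn ℂ (lameNested a b c q α lam ρ n) (Metric.ball 0 1) ∧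
        ∀ w : ℂ, ‖w‖ < 1 →
          (∀ t ∈ Set.Ioo (0 : ℝ) 1, ∀ u ∈ Set.Ioo (0 : ℝ) 1,
            CircleIntegrable
              (contourIntegrand a b c q α lam (n + 1) (lameNested a b c q α lam ρ n) w t u)
              0 (ρ (n + 1) w t u)) ∧
          MeasureTheory.IntegrableOn
            (fun p : ℝ × ℝ => (p.1 : ℂ) ^ (1 / 2 * (((n + 1 : ℕ) : ℂ) - 5 / 2 + lam)) *
              ((p.2 : ℂ) ^ (1 / 2 * (((n + 1 : ℕ) : ℂ) - 2 + lam)) *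
                contourTerm a b c q α lam (n + 1) (lameNested a b c q α lam ρ n) w p.1 p.2
                  (ρ (n + 1) w p.1 p.2)))
            (Set.Ioo (0 : ℝ) 1 ×ˢ Set.Ioo (0 : ℝ) 1)) ∧
      -- the part of the Frobenius series with `n` factors `A` is the `n`-fold nested integral
      (∀ z ∈ U, ‖z‖ ^ 2 < ‖(a - b) * (a - c)‖ → ∀ n : ℕ,
        HasSum (fun N : ℕ => subCoeff a b c q α lam c₀ N n * (Complex.exp (lam * L z) * z ^ N))
          (c₀ * Complex.exp (lam * L z) *
            (lameNested a b c q α lam ρ n (lameEta a b c z) * lameMu a b c z ^ n))) ∧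
      -- the sum of these parts converges to a solution, which is the Frobenius solution
      (∀ x : ℂ, x - a ∈ U → ‖x - a‖ ^ 2 < ‖(a - b) * (a - c)‖ →
        ‖(2 * a - b - c) * (x - a)‖ < ‖(a - b) * (a - c) + (x - a) ^ 2‖ →
        Summable (fun n : ℕ =>
          lameNested a b c q α lam ρ n (lameEta a b c (x - a)) * lameMu a b c (x - a) ^ n) ∧
        IsLameSolutionAt a b c q α
          (fun x' => c₀ * Complex.exp (lam * L (x' - a)) *
            (lameSeries α lam (lameEta a b c (x' - a)) +
              ∑' n : ℕ, lameNested a b c q α lam ρ (n + 1) (lameEta a b c (x' - a))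
                * lameMu a b c (x' - a) ^ (n + 1))) x ∧
        (‖x - a‖ < ‖a - b‖ → ‖x - a‖ < ‖a - c‖ →
          HasSum (fun N : ℕ => frobCoeff a b c q α lam c₀ N *
              (Complex.exp (lam * L (x - a)) * (x - a) ^ N))
            (c₀ * Complex.exp (lam * L (x - a)) *
              (lameSeries α lam (lameEta a b c (x - a)) +
                ∑' n : ℕ, lameNested a b c q α lam ρ (n + 1) (lameEta a b c (x - a))
                  * lameMu a b c (x - a) ^ (n + 1))))) := by
  -- A real exponent makes the beta parameters real and positive, as the integral estimates require.
  obtain ⟨lr, hlr, rfl⟩ : ∃ lr : ℝ, (lr = 0 ∨ lr = 1 / 2) ∧ lam = (lr : ℂ) := by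
    rcases hlam with rfl | rfl
    · exact ⟨0, Or.inl rfl, by simp⟩
    · exact ⟨1 / 2, Or.inr rfl, by push_cast; rfl⟩
  have h0 : 0 ≤ lr := by rcases hlr with rfl | rfl <;> norm_num
  refine ⟨?_, fun w hw => ⟨((psConv_nestedCoeff a b c q α h0 0).hasSum hw).summable,
    lameSeries_eq_hypergeometric hlam w⟩, fun ρ hρ => ?_⟩
  · classical
    refine ⟨fun _ w t u => if h : ∃ r, AdmissibleRadius w t u r then h.choose else 0,
      fun l w hw t ht u hu => ?_⟩
    have h := exists_admissibleRadius hw ht hu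
    simpa only [dif_pos h] using h.choose_spec
  have hN : ∀ n, Set.EqOn (lameNested a b c q α lr ρ n) (psum (nestedCoeff a b c q α lr n))
      (Metric.ball 0 1) := eqOn_lameNested h0 hρ
  have hpart : ∀ n (z : ℂ), ‖z‖ ^ 2 < ‖(a - b) * (a - c)‖ →
      lameNested a b c q α lr ρ n (lameEta a b c z) * lameMu a b c z ^ n
        = frobPart a b c q α lr n z := fun n z hz => by
    rw [hN n (mem_ball_zero_iff.2 (norm_lameEta_lt_one hab hac hz)), frobPart,
      psum_subCoeff hab hac h0 n hz]
  have hsum : ∀ z ∈ lameRegion a b c,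
      HasSum (fun n => lameNested a b c q α lr ρ n (lameEta a b c z) * lameMu a b c z ^ n)
        (frobSum a b c q α lr z) := fun z hz =>
    (hasSum_congr fun n => hpart n z hz.1).2 (frobSum_facts q α hab hac hlr hz).2.1
  have hsplit : ∀ z ∈ lameRegion a b c, lameSeries α lr (lameEta a b c z)
      + ∑' n : ℕ, lameNested a b c q α lr ρ (n + 1) (lameEta a b c z) * lameMu a b c z ^ (n + 1)
        = frobSum a b c q α lr z := fun z hz => by
    rw [← (hsum z hz).tsum_eq, (hsum z hz).summable.tsum_eq_zero_add, pow_zero, mul_one]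
    rfl
  refine ⟨fun n => ⟨?_, fun w hw => ?_⟩, fun z _ hz n => ?_, fun x hxU hx1 hx2 => ?_⟩
  · exact (psConv_nestedCoeff a b c q α h0 n).differentiableOn_and_hasSum_deriv.1.congr (hN n)
  · have h := nested_step h0 hρ (hN n) hw
    exact ⟨h.1, h.2.1⟩
  · have h := ((psConv_subCoeff q α hab hac h0 n).hasSum
      (mem_ball_zero_iff.1 (mem_ball_sqrt.2 hz))).mul_left (c₀ * Complex.exp (lr * L z))
    rw [hpart n z hz]
    refine (hasSum_congr fun N => ?_).2 h
    rw [subCoeff_eq_mul]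
    ring
  · have hxr : x - a ∈ lameRegion a b c := ⟨hx1, hx2⟩
    refine ⟨(hsum _ hxr).summable, ?_, fun h1 h2 => ?_⟩
    · refine (isLameSolutionAt_frobSum q α c₀ hab hac hlr hU hLcont hLexp hxU hxr).congr ?_
      -- Being a solution involves derivatives, so the two expressions must agree on a neighbourhood
      -- of `x`.
      have hopen : IsOpen {x' : ℂ | x' - a ∈ lameRegion a b c} :=
        (isOpen_lameRegion a b c).preimage (continuous_id.sub continuous_const)
      filter_upwards [hopen.mem_nhds hxr] with x' hx'
      rw [hsplit _ hx', mul_assoc]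
    · have h := ((psConv_frobCoeff q α lr hab hac).hasSum (lt_min h1 h2)).mul_left
        (c₀ * Complex.exp (lr * L (x - a)))
      rw [psum_frobCoeff_eq_frobSum q α hab hac hlr hxr (lt_min h1 h2)] at h
      rw [hsplit _ hxr]
      refine (hasSum_congr fun N => ?_).2 h
      rw [frobCoeff_eq_mul]
      ring
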